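/- **Setting.** Let $1\le d\le n$, $\delta\in(0,1/2)$, and observe $Y_i=\eta_i\theta+\xi_i\in\mathbf{R}^d$, $i=1,\dots,n$, where $\theta\in\mathbf{R}^d$ is unknown; $(\eta_i)$ is a homogeneous Markov chain on $\{-1,1\}$ with $\eta_1$ Rademacher and $\eta_{i+1}=\eta_i$ with probability $1-\delta$, $\eta_{i+1}=-\eta_i$ with probability $\delta$; $\xi_1,\dots,\xi_n$ are i.i.d. isotropic random vectors, independent of $\eta$, with $\mathbf{E}\,e^{\langle v,\xi_i\rangle}\le e^{\|v\|^2/2}$ for all $v\in\mathbf{R}^d$. Write $\ell(x,y)=\min\{\|x-y\|,\|x+y\|\}$ for the loss. For an integer $1\le \ell\le n$ put $k=\lfloor n/\ell\rfloor$, let $\tilde Y\in\mathbf{R}^{d\times \ell}$ have as columns the means of the first $\ell$ consecutive blocks of $k$ observations (a remainder of $n-k\ell$ observations, if any, is dropped), let $\hat\Sigma=\frac1\ell\tilde Y\tilde Y^\top$, and set $$\tilde\theta(\ell)=\sqrt{\left(\lambda_{\max}(\hat\Sigma)-\tfrac1k\right)_+}\;v_{\max}(\hat\Sigma),$$ with $v_{\max}(\hat\Sigma)$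 a unit eigenvector for the top eigenvalue $\lambda_{\max}(\hat\Sigma)$ (any choice). Let $g_i=2^id$ for $i=0,\dots,M$, where $M$ is the largest integer with $2^Md\le n$. For $C>0$ let $\tilde m$ be the smallest $m\in\{0,\dots,M\}$ such that for all $k\in\{m+1,\dots,M\}$ $$\ell^2(\tilde\theta(g_k),\tilde\theta(g_{k-1}))\le 4C^2\left(\frac{\sqrt{dg_k}}{n}\wedge\frac{dg_k}{n^2\|\tilde\theta(g_k)\|^2}\right),$$ and put $\tilde\ell=g_{\tilde m}$. Let $\tilde m_2$ be the smallest $m\in\{0,\dots,M\}$ such that for all $k\in\{m+1,\dots,M\}$ $$\ell^2(\tilde\theta(g_k),\tilde\theta(g_{k-1}))\le 4C^2\left(\frac{\sqrt{dg_k}}{n}\wedge\frac{dg_k}{n^2\|\tilde\theta(\tilde\ell)\|^2}\right),$$ and put $\tilde\ell_2=g_{\tilde m_2}$. Finally let $$\ell^{**}=d\vee\left\lceil n\delta\vee\frac{\delta^{2/3}n^{4/3}\|\theta\|^{4/3}}{d^{1/3}}\vee n\|\theta\|^2\right\rceil\wedge n .$$ A minimum in which one term has denominator $0$ is read as the other term.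 **Theorem 5.** There is an absolute constant $C_0>0$ such that for every $C\ge C_0$ there are constants $c,c_0,c_1>0$, depending on nothing but $C$, such that the following holds for all $1\le d\le n$, all $\delta\in(0,1/2)$, all $\theta$ with $\|\theta\|^2\le1$, and all laws of the noise as above. Put $L=\log(n/d)$ if $d<n$ and $L=1$ if $d=n$. With probability at least $1-c_1Le^{-c_0d}$, $$\ell^2(\tilde\theta(\tilde\ell_2),\theta)\le c\left[\left(\sqrt{\frac{\delta d}{n}}+\frac dn\right)\wedge\left(\frac{\ell^{**}d}{n^2\|\theta\|^2}+\frac dn\right)\right].$$ In particular, with probability at least $1-c_1Le^{-c_0d}$, $$\ell^2(\tilde\theta(\tilde\ell_2),\theta)\le c\left(\sqrt{\frac{\delta d}{n}}+\frac dn\right).$$ -/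

import Mathlib

open MeasureTheory ProbabilityTheory
open scoped Matrix

noncomputable section

namespace MarkovMixture

/-! ### The model -/

/-- `η` is a homogeneous symmetric two-state Markov chain of signs with flip probability `δ`,
started from a Rademacher variable. It is given by its path law: a sign path `e` has
probability `1/2` times a factor `1 - δ` for each step without a flip and `δ` for each flip.
These probabilities sum to one, so the `η i` are signs almost surely. -/
structure IsSignChain {Ω : Type*} [MeasurableSpace Ω] (P : Measure Ω) {n : ℕ} (δ : ℝ)
    (η : Fin n → Ω → ℝ) : Prop where
  measurable : ∀ i, Measurable (η i)
  path_law : ∀ e : Fin n → ℝ, (∀ i, e i = 1 ∨ e i = -1) →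
    P {ω | ∀ i, η i ω = e i} =
      ENNReal.ofReal ((1 / 2) * ∏ i : Fin n,
        if h : (i : ℕ) + 1 < n then (if e ⟨i + 1, h⟩ = e i then 1 - δ else δ) else 1)

/-- `ξ` is a family of i.i.d. isotropic `1`-sub-Gaussian random vectors of `ℝᵈ`. -/
structure IsNoise {Ω : Type*} [MeasurableSpace Ω] (P : Measure Ω) {n d : ℕ}
    (ξ : Fin n → Ω → EuclideanSpace ℝ (Fin d)) : Prop where
  measurable : ∀ i, Measurable (ξ i)
  indep : iIndepFun ξ P
  ident : ∀ i j, IdentDistrib (ξ i) (ξ j) P P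
  isotropic : ∀ i (u v : EuclideanSpace ℝ (Fin d)),
    ∫ ω, inner ℝ u (ξ i ω) * inner ℝ v (ξ i ω) ∂P = inner ℝ u v
  subGaussian : ∀ i (v : EuclideanSpace ℝ (Fin d)),
    Integrable (fun ω => Real.exp (inner ℝ v (ξ i ω))) P ∧
      ∫ ω, Real.exp (inner ℝ v (ξ i ω)) ∂P ≤ Real.exp (‖v‖ ^ 2 / 2)

/-- The hidden Markov sub-Gaussian mixture: labels `η`, noise `ξ`, with `ξ` independent
of `η`. -/
structure IsModel {Ω : Type*} [MeasurableSpace Ω] (P : Measure Ω) {n d : ℕ} (δ : ℝ)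
    (η : Fin n → Ω → ℝ) (ξ : Fin n → Ω → EuclideanSpace ℝ (Fin d)) : Prop where
  chain : IsSignChain P δ η
  noise : IsNoise P ξ
  indep : IndepFun (fun ω i => ξ i ω) (fun ω i => η i ω) P

/-- The observations `Y i = η i • θ + ξ i`. -/
def obs {Ω : Type*} {n d : ℕ} (θ : EuclideanSpace ℝ (Fin d)) (η : Fin n → Ω → ℝ)
    (ξ : Fin n → Ω → EuclideanSpace ℝ (Fin d)) (ω : Ω) (i : Fin n) :
    EuclideanSpace ℝ (Fin d) :=
  η i ω • θ + ξ i ω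

/-- The loss up to a global sign, `min (‖x - y‖) (‖x + y‖)`. -/
def signLoss {d : ℕ} (x y : EuclideanSpace ℝ (Fin d)) : ℝ :=
  min ‖x - y‖ ‖x + y‖

/-! ### The spectral estimator with `l` buckets -/

/-- The bucket length `k = ⌊n / l⌋` (the exact quotient if `l` divides `n`). -/
def bucketLen (n l : ℕ) : ℕ := n / l

/-- The indices of the `i`-th bucket: the `i`-th block of `k` consecutive indices. If `l` does
not divide `n`, the last `n - k * l` indices are in no bucket. -/
def bucket (n l : ℕ) (i : Fin l) : Finset (Fin n) :=
  Finset.univ.filter fun j =>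
    (i : ℕ) * bucketLen n l ≤ (j : ℕ) ∧ (j : ℕ) < ((i : ℕ) + 1) * bucketLen n l

/-- The `d × l` matrix whose columns are the bucket means. -/
def bucketMeans {n d : ℕ} (y : Fin n → EuclideanSpace ℝ (Fin d)) (l : ℕ) :
    Matrix (Fin d) (Fin l) ℝ :=
  Matrix.of fun a i => (1 / (bucketLen n l : ℝ)) * ∑ j ∈ bucket n l i, y j a

/-- The empirical second moment matrix of the bucket means. -/
def sampleCov {n d : ℕ} (y : Fin n → EuclideanSpace ℝ (Fin d)) (l : ℕ) :
    Matrix (Fin d) (Fin d) ℝ :=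
  (1 / (l : ℝ)) • (bucketMeans y l * (bucketMeans y l)ᵀ)

/-- The largest eigenvalue of a real symmetric matrix. -/
def lambdaMax {d : ℕ} (A : Matrix (Fin d) (Fin d) ℝ) : ℝ := sSup (spectrum ℝ A)

/-- `v` selects a unit top eigenvector of every real symmetric matrix. -/
def IsTopEigenvectorMap {d : ℕ}
    (v : Matrix (Fin d) (Fin d) ℝ → EuclideanSpace ℝ (Fin d)) : Prop :=
  ∀ A : Matrix (Fin d) (Fin d) ℝ, A.IsSymm →
    ‖v A‖ = 1 ∧ Matrix.toEuclideanLin A (v A) = lambdaMax A • v A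

/-- The estimator `θ̃(l)`, computed from the data `y`. -/
def spectralEst {n d : ℕ} (v : Matrix (Fin d) (Fin d) ℝ → EuclideanSpace ℝ (Fin d))
    (y : Fin n → EuclideanSpace ℝ (Fin d)) (l : ℕ) : EuclideanSpace ℝ (Fin d) :=
  √(max (lambdaMax (sampleCov y l) - 1 / (bucketLen n l : ℝ)) 0) • v (sampleCov y l)

/-! ### The two-step Lepski choice of the number of buckets -/

/-- The grid point `g_i = 2 ^ i * d`. -/
def grid (d i : ℕ) : ℕ := 2 ^ i * d

/-- The largest `M` with `2 ^ M * d ≤ n` (for `1 ≤ d ≤ n`). -/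
def gridTop (n d : ℕ) : ℕ := Nat.findGreatest (fun M => 2 ^ M * d ≤ n) n

/-- The squared threshold `4 C² (√(d g) / n ∧ d g / (n² s²))`; for `s = 0` the second term is
infinite. -/
def threshold (C : ℝ) (n d g : ℕ) (s : ℝ) : ℝ :=
  4 * C ^ 2 *
    (if s = 0 then √((d : ℝ) * g) / n
      else min (√((d : ℝ) * g) / n) ((d : ℝ) * g / ((n : ℝ) ^ 2 * s ^ 2)))

/-- The least `m ≤ M` such that consecutive estimators on the grid differ, in squared loss, by at
most `thr k` for all `k` in `{m + 1, …, M}`. The set contains `M`. -/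
def lepskiIndex {d : ℕ} (n : ℕ) (T : ℕ → EuclideanSpace ℝ (Fin d)) (thr : ℕ → ℝ) : ℕ :=
  sInf {m | m ≤ gridTop n d ∧ ∀ k, m + 1 ≤ k → k ≤ gridTop n d →
    signLoss (T (grid d k)) (T (grid d (k - 1))) ^ 2 ≤ thr k}

/-- The first choice, with the norm of the `k`-th grid estimator in the `k`-th threshold. -/
def ellTilde {n d : ℕ} (C : ℝ) (v : Matrix (Fin d) (Fin d) ℝ → EuclideanSpace ℝ (Fin d))
    (y : Fin n → EuclideanSpace ℝ (Fin d)) : ℕ :=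
  grid d (lepskiIndex n (spectralEst v y)
    fun k => threshold C n d (grid d k) ‖spectralEst v y (grid d k)‖)

/-- The refined choice, with the norm of the first adaptive estimator in all thresholds. -/
def ellTildeTwo {n d : ℕ} (C : ℝ) (v : Matrix (Fin d) (Fin d) ℝ → EuclideanSpace ℝ (Fin d))
    (y : Fin n → EuclideanSpace ℝ (Fin d)) : ℕ :=
  grid d (lepskiIndex n (spectralEst v y)
    fun k => threshold C n d (grid d k) ‖spectralEst v y (ellTilde C v y)‖)

/-- The fully adaptive estimator: a function of the data alone. -/
def adaptiveEst {n d : ℕ} (C : ℝ) (v : Matrix (Fin d) (Fin d) ℝ → EuclideanSpace ℝ (Fin d))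
    (y : Fin n → EuclideanSpace ℝ (Fin d)) : EuclideanSpace ℝ (Fin d) :=
  spectralEst v y (ellTildeTwo C v y)

/-! ### The rates -/

/-- The oracle number of buckets `ℓ**`. -/
def ellStarStar (n d : ℕ) (δ : ℝ) (θ : EuclideanSpace ℝ (Fin d)) : ℕ :=
  min (max d ⌈max (max ((n : ℝ) * δ)
    (δ ^ (2 / 3 : ℝ) * (n : ℝ) ^ (4 / 3 : ℝ) * ‖θ‖ ^ (4 / 3 : ℝ) / (d : ℝ) ^ (1 / 3 : ℝ)))
    ((n : ℝ) * ‖θ‖ ^ 2)⌉₊) n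

/-- The global rate `√(δ d / n) + d / n`. -/
def globalRate (n d : ℕ) (δ : ℝ) : ℝ := √(δ * d / n) + (d : ℝ) / n

/-- The local rate `(√(δ d / n) + d / n) ∧ (ℓ** d / (n² ‖θ‖²) + d / n)`; for `θ = 0` the second
term is infinite. -/
def localRate (n d : ℕ) (δ : ℝ) (θ : EuclideanSpace ℝ (Fin d)) : ℝ :=
  if θ = 0 then globalRate n d δ
  else min (globalRate n d δ)
    ((ellStarStar n d δ θ : ℝ) * d / ((n : ℝ) ^ 2 * ‖θ‖ ^ 2) + (d : ℝ) / n)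

/-- The factor `log (n / d)` in the exceptional probability, replaced by `1` in the degenerate
case `n = d`, where the logarithm vanishes. -/
def logFactor (n d : ℕ) : ℝ := if n = d then 1 else Real.log ((n : ℝ) / d)

end MarkovMixture

end

open MarkovMixture

namespace MarkovMixture

/-! ### The loss up to a sign -/

section SignLoss

variable {d : ℕ} (x y z : EuclideanSpace ℝ (Fin d))

/-! Fix `l` buckets and let `a` be the quadratic mean of the bucket averages of the labels. The
sample covariance is `a² θθᵀ + (1/k) I` plus an error from the noise covariance and the label-noise
cross term. On a likely event, and as soon as `n‖θ‖² ≤ 2l`, this error has operator norm of order `A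
= √(d l) / n` (`noiseLevel`). A rank-one perturbation bound (`signLoss_rankOne_perturbation`) then
gives squared loss at most of order `A`, and of order `A² / ‖θ‖²`, with respect to `a θ`. A bucket
without flips has average `±1`, so `1 - a²` is at most the number of flips divided by `l`; with at
most `2nδ + d` flips the bias `(1 - a)‖θ‖` is dominated by the same two quantities once `l` is a
multiple of the oracle level (`bias_le`). At the last grid point the buckets are singletons and
there is no bias, so truncation of the oracle at `n` costs nothing.

Hence both bounds hold at every grid point beyond an oracle index, and the rest of the choice is
deterministic (`two_step_lepski`). The first Lepski step is used only through its `A`-thresholds: it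
locates `‖θ‖` up to a multiple of `√A` at the oracle. If `‖θ‖` is larger than that error, the pilot
norm is at least `‖θ‖ / 2` and the second step telescopes at the local rate; otherwise the local
bound follows from the global one. `le_rates` converts `A` at the oracle into the stated rates,
according to the term that attains the maximum in the oracle level.

The likely event costs `exp (-d)` for the flips (Chernoff over sign paths), and `exp (-d)` twice at
each grid point: for the noise covariance (Bernstein on a net) and for the cross term (sub-Gaussian
tails given the labels). The grid has order `log (n / d)` points, or a single one when `n / d` is
near `1`; halving the exponent pays for the latter case. -/

lemma signLoss_nonneg : 0 ≤ signLoss x y := le_min (norm_nonneg _) (norm_nonneg _)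

lemma signLoss_comm : signLoss x y = signLoss y x := by
  unfold signLoss
  rw [norm_sub_rev, add_comm]

lemma signLoss_neg_left : signLoss (-x) y = signLoss x y := by
  unfold signLoss
  rw [show -x - y = -(x + y) by abel, show -x + y = -(x - y) by abel, norm_neg, norm_neg, min_comm]

/-- The loss is the distance modulo `±1`: the signs attaining the two minima compose, which gives
the four cases. -/
lemma signLoss_triangle : signLoss x z ≤ signLoss x y + signLoss y z := by
  have h1 : ‖x - z‖ ≤ ‖x - y‖ + ‖y - z‖ := norm_sub_le_norm_sub_add_norm_sub x y z
  have h2 : ‖x + z‖ ≤ ‖x - y‖ + ‖y + z‖ := by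
    simpa [sub_eq_add_neg] using norm_sub_le_norm_sub_add_norm_sub x y (-z)
  have h3 : ‖x + z‖ ≤ ‖x + y‖ + ‖y - z‖ := by
    have := norm_sub_le (x + y) (y - z)
    rwa [show x + y - (y - z) = x + z by abel] at this
  have h4 : ‖x - z‖ ≤ ‖x + y‖ + ‖y + z‖ := by
    have := norm_sub_le (x + y) (y + z)
    rwa [show x + y - (y + z) = x - z by abel] at this
  unfold signLoss
  rcases min_choice ‖x - y‖ ‖x + y‖ with h | h <;> rcases min_choice ‖y - z‖ ‖y + z‖ with h' | h' <;>
    rw [h, h']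
  exacts [(min_le_left _ _).trans h1, (min_le_right _ _).trans h2, (min_le_right _ _).trans h3,
    (min_le_left _ _).trans h4]

lemma abs_norm_sub_norm_le_signLoss : |‖x‖ - ‖y‖| ≤ signLoss x y := by
  refine le_min (abs_norm_sub_norm_le x y) ?_
  simpa using abs_norm_sub_norm_le x (-y)

lemma signLoss_smul_self_le (a : ℝ) : signLoss (a • x) x ≤ |1 - a| * ‖x‖ := by
  refine (min_le_left _ _).trans ?_
  rw [show a • x - x = -((1 - a) • x) by rw [sub_smul, one_smul]; abel, norm_neg, norm_smul,
    Real.norm_eq_abs]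

end SignLoss

/-! ### Perturbation of a rank-one matrix -/

/-- Here `T` is within `ε` of `κ I + u uᵀ` as a bilinear form. If `‖u‖² ≤ 8ε` the signal is lost and
both vectors have norm of order `√ε`. Otherwise the eigenvalue equation shows that `s² w` is within
`ε` of a multiple of `u`, so dividing by `s`, comparable to `‖u‖`, gives an error of order `ε /
‖u‖`. No symmetry or spectral gap is assumed. -/
lemma signLoss_rankOne_perturbation {d : ℕ}
    (T : EuclideanSpace ℝ (Fin d) →ₗ[ℝ] EuclideanSpace ℝ (Fin d))
    {u w : EuclideanSpace ℝ (Fin d)} {lam κ ε : ℝ} (hw : ‖w‖ = 1) (hTw : T w = lam • w)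
    (hmax : ∀ x, inner ℝ x (T x) ≤ lam * ‖x‖ ^ 2)
    (hT : ∀ x z, |inner ℝ x (T z) - κ * inner ℝ x z - inner ℝ x u * inner ℝ z u|
      ≤ ε * ‖x‖ * ‖z‖) :
    signLoss (√(max (lam - κ) 0) • w) u ^ 2 ≤ 34 * ε ∧
      signLoss (√(max (lam - κ) 0) • w) u ^ 2 * ‖u‖ ^ 2 ≤ 272 * ε ^ 2 := by
  wlog hpos : 0 ≤ (inner ℝ w u : ℝ) generalizing w with H
  · have := @H (-w) (by rwa [norm_neg]) (by simp [hTw]) (by rw [inner_neg_left]; linarith)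
    simpa only [smul_neg, signLoss_neg_left] using this
  set p : ℝ := inner ℝ w u with hp
  set U : ℝ := ‖u‖ with hU
  set s : ℝ := √(max (lam - κ) 0) with hs
  have hU0 : 0 ≤ U := norm_nonneg _
  have hs0 : 0 ≤ s := Real.sqrt_nonneg _
  have hs2 : s ^ 2 = max (lam - κ) 0 := Real.sq_sqrt (le_max_right _ _)
  have hww : (inner ℝ w w : ℝ) = 1 := by rw [real_inner_self_eq_norm_sq, hw]; norm_num
  have huu : (inner ℝ u u : ℝ) = U ^ 2 := by rw [real_inner_self_eq_norm_sq]
  have hpU : p ≤ U := by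
    have := real_inner_le_norm w u
    rwa [hw, one_mul] at this
  have h1 : |lam - κ - p ^ 2| ≤ ε := by
    have := hT w w
    rw [hTw, inner_smul_right, hww, hw] at this
    simpa [← hp, sq] using this
  have hε : 0 ≤ ε := (abs_nonneg _).trans h1
  -- Testing the top eigenvalue with `u` bounds it below; `h1`, tested with `w`, gives the upper
  -- bound through `p ≤ U`.
  have h2 : U ^ 2 * U ^ 2 - ε * U ^ 2 ≤ (lam - κ) * U ^ 2 := by
    have h := (abs_le.1 (hT u u)).1
    have h' := hmax u
    rw [huu] at h
    nlinarith
  have hloss : signLoss (s • w) u ≤ ‖s • w - u‖ := min_le_left _ _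
  have hl0 := signLoss_nonneg (s • w) u
  have h1' := abs_le.1 h1
  have hpsq : p ^ 2 ≤ U ^ 2 := pow_le_pow_left₀ hpos hpU 2
  -- Weak signal: `s² ≤ 9ε`, so the loss is at most `2 · 9ε + 2 · 8ε = 34ε`, and `272 = 34 · 8`.
  by_cases hc : U ^ 2 ≤ 8 * ε
  · have hn : ‖s • w - u‖ ≤ s + U := by
      refine (norm_sub_le _ _).trans ?_
      rw [norm_smul, hw, mul_one, Real.norm_eq_abs, abs_of_nonneg hs0]
    have hsle : s ^ 2 ≤ U ^ 2 + ε := by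
      rw [hs2]; exact max_le (by linarith) (by positivity)
    have hA : signLoss (s • w) u ^ 2 ≤ 34 * ε := by
      calc signLoss (s • w) u ^ 2 ≤ (s + U) ^ 2 := pow_le_pow_left₀ hl0 (hloss.trans hn) 2
        _ ≤ 2 * s ^ 2 + 2 * U ^ 2 := by nlinarith [sq_nonneg (s - U)]
        _ ≤ 34 * ε := by linarith
    refine ⟨hA, ?_⟩
    calc signLoss (s • w) u ^ 2 * U ^ 2 ≤ (34 * ε) * (8 * ε) :=
          mul_le_mul hA hc (by positivity) (by positivity)
      _ = 272 * ε ^ 2 := by ring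
  · push Not at hc
    have hUpos : 0 < U := by
      rcases hU0.lt_or_eq with h | h
      · exact h
      · rw [← h] at hc; norm_num at hc; linarith
    have h3 : U ^ 2 - ε ≤ lam - κ := by
      have : 0 < U ^ 2 := by positivity
      nlinarith
    have hs2' : s ^ 2 = lam - κ := by rw [hs2, max_eq_left]; linarith
    have hslow : 7 / 8 * U ^ 2 ≤ s ^ 2 := by rw [hs2']; linarith
    have hsup : s ≤ 9 / 8 * U := by
      refine abs_le_of_sq_le_sq' ?_ (by positivity) |>.2
      nlinarith
    have hspos : 0 < s := by
      rcases hs0.lt_or_eq with h | h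
      · exact h
      · rw [← h] at hslow; nlinarith
    -- This vector is the perturbation `T - κ - u uᵀ` applied to `w`; it is tested against itself.
    have hr : ‖s ^ 2 • w - p • u‖ ≤ ε := by
      set r := s ^ 2 • w - p • u with hr
      have h := (abs_le.1 (hT r w)).2
      rw [hTw, inner_smul_right, hw, mul_one] at h
      have hrr : lam * inner ℝ r w - κ * inner ℝ r w - inner ℝ r u * p = ‖r‖ ^ 2 := by
        rw [← real_inner_self_eq_norm_sq]
        have : (inner ℝ r r : ℝ) = s ^ 2 * inner ℝ r w - p * inner ℝ r u := by
          rw [← inner_smul_right, ← inner_smul_right, ← inner_sub_right]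
        rw [this, hs2']
        ring
      rw [← hp, hrr] at h
      by_contra hcon
      push Not at hcon
      nlinarith [norm_nonneg r]
    have hps : |p - s| * s ≤ ε := by
      have : |p - s| * (p + s) ≤ ε := by
        rw [← abs_of_nonneg (by positivity : 0 ≤ p + s), ← abs_mul,
          show (p - s) * (p + s) = -(lam - κ - p ^ 2) by rw [← hs2']; ring, abs_neg]
        exact h1
      nlinarith [abs_nonneg (p - s)]
    have hD : s * ‖s • w - u‖ ≤ ε + |p - s| * U := by
      have : s • (s • w - u) = (s ^ 2 • w - p • u) + (p - s) • u := by
        rw [smul_sub, smul_smul, sub_smul, sq]; abel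
      calc s * ‖s • w - u‖ = ‖s • (s • w - u)‖ := by
            rw [norm_smul, Real.norm_eq_abs, abs_of_pos hspos]
        _ ≤ ε + |p - s| * U := by
            rw [this]
            refine (norm_add_le _ _).trans (add_le_add hr ?_)
            rw [norm_smul, Real.norm_eq_abs]
    have hUD : U * ‖s • w - u‖ ≤ 3 * ε := by
      set D := ‖s • w - u‖
      have hD0 : 0 ≤ D := norm_nonneg _
      have e1 : s ^ 2 * D ≤ ε * s + ε * U := by
        calc s ^ 2 * D = s * (s * D) := by ring
          _ ≤ s * (ε + |p - s| * U) := by gcongr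
          _ = ε * s + (|p - s| * s) * U := by ring
          _ ≤ ε * s + ε * U := by gcongr
      have e2 : 7 / 8 * U ^ 2 * D ≤ ε * (9 / 8 * U) + ε * U := by
        calc 7 / 8 * U ^ 2 * D ≤ s ^ 2 * D := by gcongr
          _ ≤ ε * s + ε * U := e1
          _ ≤ _ := by gcongr
      have e3 : U * (U * D) ≤ U * (3 * ε) := by
        have : 0 ≤ ε * U := by positivity
        linarith [e2, show U * (U * D) = U ^ 2 * D by ring, show U * (3 * ε) = 3 * (ε * U) by ring]
      exact le_of_mul_le_mul_left e3 hUpos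
    have hUL : U * signLoss (s • w) u ≤ 3 * ε := (mul_le_mul_of_nonneg_left hloss hU0).trans hUD
    have h9 : signLoss (s • w) u ^ 2 * U ^ 2 ≤ 9 * ε ^ 2 := by
      calc signLoss (s • w) u ^ 2 * U ^ 2 = (U * signLoss (s • w) u) ^ 2 := by ring
        _ ≤ (3 * ε) ^ 2 := pow_le_pow_left₀ (by positivity) hUL 2
        _ = _ := by ring
    refine ⟨?_, by linarith [sq_nonneg ε]⟩
    by_contra hcon
    push Not at hcon
    have : 34 * ε * (8 * ε) ≤ signLoss (s • w) u ^ 2 * U ^ 2 := by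
      apply mul_le_mul hcon.le hc.le (by positivity) (by positivity)
    rcases hε.lt_or_eq with h | h
    · linarith [pow_pos h 2, show 34 * ε * (8 * ε) = 272 * ε ^ 2 by ring]
    · rw [← h] at h9 hcon
      have : 0 < signLoss (s • w) u ^ 2 * U ^ 2 := by
        apply mul_pos _ (by positivity)
        linarith
      linarith

/-! ### The top eigenvalue and the sample covariance -/

/-- In finite dimension the supremum of the Rayleigh quotient is an eigenvalue, hence lies below the
supremum of the spectrum. -/
lemma inner_le_lambdaMax {d : ℕ} {A : Matrix (Fin d) (Fin d) ℝ} (hA : A.IsSymm)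
    (x : EuclideanSpace ℝ (Fin d)) :
    inner ℝ x (Matrix.toEuclideanLin A x) ≤ lambdaMax A * ‖x‖ ^ 2 := by
  rcases eq_or_ne x 0 with rfl | hx
  · simp
  have : Nontrivial (EuclideanSpace ℝ (Fin d)) := ⟨x, 0, hx⟩
  have hH : A.IsHermitian := by rwa [Matrix.IsHermitian, Matrix.conjTranspose_eq_transpose_of_trivial]
  have hS : (Matrix.toEuclideanLin A).IsSymmetric := Matrix.isSymmetric_toEuclideanLin_iff.2 hH
  have hspec := hS.hasEigenvalue_iSup_of_finiteDimensional.mem_spectrum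
  rw [Matrix.spectrum_toLpLin] at hspec
  have hle := le_csSup (Matrix.finite_real_spectrum (A := A)).bddAbove hspec
  set T' : EuclideanSpace ℝ (Fin d) →L[ℝ] EuclideanSpace ℝ (Fin d) :=
    LinearMap.toContinuousLinearMap (Matrix.toEuclideanLin A) with hT'
  -- A real `iSup` bounds its terms only if the family is bounded; the operator norm supplies this.
  have hbdd : BddAbove (Set.range fun x : {x : EuclideanSpace ℝ (Fin d) // x ≠ 0} =>
      RCLike.re (inner ℝ (Matrix.toEuclideanLin A x) (x : EuclideanSpace ℝ (Fin d))) /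
        ‖(x : EuclideanSpace ℝ (Fin d))‖ ^ 2) := by
    refine ⟨‖T'‖, ?_⟩
    rintro _ ⟨⟨z, hz⟩, rfl⟩
    have hz' : 0 < ‖z‖ := norm_pos_iff.2 hz
    simp only [RCLike.re_to_real]
    rw [div_le_iff₀ (by positivity)]
    calc (inner ℝ (Matrix.toEuclideanLin A z) z : ℝ) ≤ ‖T' z‖ * ‖z‖ := real_inner_le_norm _ _
      _ ≤ ‖T'‖ * ‖z‖ * ‖z‖ := by gcongr; exact T'.le_opNorm z
      _ = ‖T'‖ * ‖z‖ ^ 2 := by ring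
  have h1 := (le_ciSup hbdd ⟨x, hx⟩).trans hle
  have hx' : 0 < ‖x‖ := norm_pos_iff.2 hx
  simp only [RCLike.re_to_real] at h1
  rw [div_le_iff₀ (by positivity), real_inner_comm] at h1
  exact h1

/-- The mean of the vectors of the `i`-th bucket. -/
noncomputable def bucketMean {n d : ℕ} (y : Fin n → EuclideanSpace ℝ (Fin d)) (l : ℕ) (i : Fin l) :
    EuclideanSpace ℝ (Fin d) :=
  (1 / (bucketLen n l : ℝ)) • ∑ j ∈ bucket n l i, y j

lemma sampleCov_isSymm {n d : ℕ} (y : Fin n → EuclideanSpace ℝ (Fin d)) (l : ℕ) :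
    (sampleCov y l).IsSymm := by
  unfold sampleCov Matrix.IsSymm
  rw [Matrix.transpose_smul, Matrix.transpose_mul, Matrix.transpose_transpose]

lemma inner_sampleCov {n d : ℕ} (y : Fin n → EuclideanSpace ℝ (Fin d)) (l : ℕ)
    (x z : EuclideanSpace ℝ (Fin d)) :
    inner ℝ x (Matrix.toEuclideanLin (sampleCov y l) z) =
      1 / (l : ℝ) * ∑ i, inner ℝ x (bucketMean y l i) * inner ℝ z (bucketMean y l i) := by
  have hm : ∀ (x : EuclideanSpace ℝ (Fin d)) (i : Fin l),
      inner ℝ x (bucketMean y l i) = ∑ a, bucketMeans y l a i * x a := by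
    intro x i
    simp [PiLp.inner_apply, bucketMean, bucketMeans]
  simp only [hm]
  rw [PiLp.inner_apply]
  simp only [sampleCov, Matrix.toLpLin_apply, Matrix.mulVec, dotProduct, Matrix.smul_apply,
    Matrix.mul_apply, Matrix.transpose_apply, smul_eq_mul, RCLike.inner_apply, conj_trivial]
  simp only [Finset.mul_sum, Finset.sum_mul]
  rw [Finset.sum_comm]
  simp_rw [Finset.sum_comm (s := (Finset.univ : Finset (Fin l)))]
  refine Finset.sum_congr rfl fun _ _ => Finset.sum_congr rfl fun _ _ => Finset.sum_congr rfl
    fun _ _ => by ring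

/-! ### The two-step Lepski argument -/

lemma lepskiIndex_spec {d n : ℕ} (T : ℕ → EuclideanSpace ℝ (Fin d)) (thr : ℕ → ℝ) :
    lepskiIndex n T thr ≤ gridTop n d ∧ ∀ k, lepskiIndex n T thr + 1 ≤ k → k ≤ gridTop n d →
      signLoss (T (grid d k)) (T (grid d (k - 1))) ^ 2 ≤ thr k :=
  Nat.sInf_mem (s := {m | m ≤ gridTop n d ∧ ∀ k, m + 1 ≤ k → k ≤ gridTop n d →
    signLoss (T (grid d k)) (T (grid d (k - 1))) ^ 2 ≤ thr k})
    ⟨gridTop n d, le_rfl, fun k h h' => by omega⟩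

lemma lepskiIndex_le {d n : ℕ} {T : ℕ → EuclideanSpace ℝ (Fin d)} {thr : ℕ → ℝ} {i : ℕ}
    (hi : i ≤ gridTop n d) (h : ∀ k, i + 1 ≤ k → k ≤ gridTop n d →
      signLoss (T (grid d k)) (T (grid d (k - 1))) ^ 2 ≤ thr k) :
    lepskiIndex n T thr ≤ i :=
  Nat.sInf_le ⟨hi, h⟩

/-- The size `√(d l) / n` of the fluctuations of the sample covariance of `l` bucket means. -/
noncomputable def noiseLevel (n d l : ℕ) : ℝ := √((d : ℝ) * l) / n

lemma noiseLevel_sq (n d l : ℕ) : noiseLevel n d l ^ 2 = (d : ℝ) * l / (n : ℝ) ^ 2 := by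
  rw [noiseLevel, div_pow, Real.sq_sqrt (by positivity)]

lemma noiseLevel_nonneg (n d l : ℕ) : 0 ≤ noiseLevel n d l := by
  unfold noiseLevel; positivity

/-- Clearing the denominator makes the convention at `s = 0` automatic: the second inequality is
then trivial. -/
lemma le_threshold_iff {C x s : ℝ} {n d g : ℕ} (hn : 0 < n) :
    x ≤ threshold C n d g s ↔
      x ≤ 4 * C ^ 2 * noiseLevel n d g ∧ x * s ^ 2 ≤ 4 * C ^ 2 * noiseLevel n d g ^ 2 := by
  have hn' : (0 : ℝ) < n := by exact_mod_cast hn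
  rw [noiseLevel_sq]
  unfold threshold noiseLevel
  split_ifs with hs
  · subst hs
    refine ⟨fun h => ⟨h, ?_⟩, fun h => h.1⟩
    rw [zero_pow two_ne_zero, mul_zero]
    positivity
  · have hs2 : 0 < s ^ 2 := by positivity
    rw [mul_min_of_nonneg _ _ (by positivity), le_min_iff]
    refine and_congr_right fun _ => ?_
    rw [← le_div_iff₀ hs2]
    field_simp

/-- Radii growing by a factor `8/7` sum to at most `1 / (1 - 7/8) = 8` times the last one. The ratio
is admissible for `√A` as well as for `A`, since `(8/7)⁴ ≤ 2` and `A²` doubles along the grid. -/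
lemma signLoss_le_of_geometric {d : ℕ} {T : ℕ → EuclideanSpace ℝ (Fin d)} {r : ℕ → ℝ} {m i : ℕ}
    (hmi : m ≤ i) (hr0 : 0 ≤ r m) (hr : ∀ k, 8 / 7 * r k ≤ r (k + 1))
    (h : ∀ k, m + 1 ≤ k → k ≤ i → signLoss (T k) (T (k - 1)) ≤ r k) :
    signLoss (T m) (T i) ≤ 8 * r i := by
  induction i, hmi using Nat.le_induction with
  | base =>
    have : signLoss (T m) (T m) = 0 := by simp [signLoss]
    linarith
  | succ i hmi ih =>
    have h1 := ih fun k hk hk' => h k hk (by omega)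
    have h2 := h (i + 1) (by omega) le_rfl
    rw [Nat.add_sub_cancel, signLoss_comm] at h2
    linarith [signLoss_triangle (T m) (T i) (T (i + 1)), hr i]

/-- Both tests accept every index beyond the oracle (up to a shift `J` in the second), so the
selected indices lie below it, and telescoping the accepted increments up to the oracle controls the
loss. The constants are `17C = 8 · 2C + C` and `34C`, twice that; `J` is large enough for `√A` at
the oracle, times `17C`, to be absorbed after `J` doublings of `A²`. -/
lemma two_step_lepski {d : ℕ} {T : ℕ → EuclideanSpace ℝ (Fin d)} {A : ℕ → ℝ} {B C : ℝ}
    {θ : EuclideanSpace ℝ (Fin d)} {J i₀ M m₁ m₂ : ℕ} (hA : ∀ i, 0 < A i)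
    (hA2 : ∀ i, A (i + 1) ^ 2 = 2 * A i ^ 2) (hB : 1 ≤ B) (hC : 2 * B ≤ C)
    (hJ : (17 * C) ^ 4 ≤ 2 ^ J) (hi₀ : i₀ ≤ M)
    (hloss : ∀ i, i₀ ≤ i → i ≤ M → signLoss (T i) θ ^ 2 ≤ B * A i ∧
      signLoss (T i) θ ^ 2 * ‖θ‖ ^ 2 ≤ B * A i ^ 2)
    (hm₁ : ∀ k, m₁ + 1 ≤ k → k ≤ M → signLoss (T k) (T (k - 1)) ^ 2 ≤ 4 * C ^ 2 * A k)
    (hm₁_min : ∀ i ≤ M, (∀ k, i + 1 ≤ k → k ≤ M →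
      signLoss (T k) (T (k - 1)) ^ 2 ≤ 4 * C ^ 2 * A k ∧
        signLoss (T k) (T (k - 1)) ^ 2 * ‖T k‖ ^ 2 ≤ 4 * C ^ 2 * A k ^ 2) → m₁ ≤ i)
    (hm₂ : ∀ k, m₂ + 1 ≤ k → k ≤ M → signLoss (T k) (T (k - 1)) ^ 2 ≤ 4 * C ^ 2 * A k ∧
        signLoss (T k) (T (k - 1)) ^ 2 * ‖T m₁‖ ^ 2 ≤ 4 * C ^ 2 * A k ^ 2)
    (hm₂_min : ∀ i ≤ M, (∀ k, i + 1 ≤ k → k ≤ M →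
      signLoss (T k) (T (k - 1)) ^ 2 ≤ 4 * C ^ 2 * A k ∧
        signLoss (T k) (T (k - 1)) ^ 2 * ‖T m₁‖ ^ 2 ≤ 4 * C ^ 2 * A k ^ 2) → m₂ ≤ i) :
    signLoss (T m₂) θ ^ 2 ≤ (34 * C) ^ 4 * 4 ^ J * A i₀ ∧
      signLoss (T m₂) θ ^ 2 * ‖θ‖ ^ 2 ≤ (34 * C) ^ 4 * 4 ^ J * A i₀ ^ 2 := by
  have hC2 : 2 ≤ C := by linarith
  have hBC2 : 16 * B ^ 2 ≤ 4 * C ^ 2 := by nlinarith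
  have hθ0 : 0 ≤ ‖θ‖ := norm_nonneg _
  have hAgrow : ∀ k, 8 / 7 * A k ≤ A (k + 1) := fun k =>
    (abs_le_of_sq_le_sq' (by nlinarith [hA2 k, hA k]) (hA (k + 1)).le).2
  have hAmono : Monotone A := monotone_nat_of_le_succ fun k => by linarith [hAgrow k, hA k]
  have hApow : ∀ i j, A (i + j) ^ 2 = 2 ^ j * A i ^ 2 := fun i j => by
    induction j with
    | zero => simp
    | succ j ih => rw [← add_assoc, hA2, ih, pow_succ]; ring
  have hbgrow : ∀ k, 8 / 7 * √(A k) ≤ √(A (k + 1)) := fun k => by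
    refine Real.le_sqrt_of_sq_le ?_
    rw [mul_pow, Real.sq_sqrt (hA k).le]
    refine (abs_le_of_sq_le_sq' ?_ (hA (k + 1)).le).2
    nlinarith [hA2 k, sq_nonneg (A k)]
  have hb2 : ∀ k, √(A k) ^ 2 = A k := fun k => Real.sq_sqrt (hA k).le
  have hstep : ∀ k, i₀ + 1 ≤ k → k ≤ M → signLoss (T k) (T (k - 1)) ^ 2 ≤ 4 * B * A k ∧
      signLoss (T k) (T (k - 1)) ^ 2 * ‖θ‖ ^ 2 ≤ 4 * B * A k ^ 2 := by
    intro k hk hkM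
    obtain ⟨h1, h1'⟩ := hloss k (by omega) hkM
    obtain ⟨h2, h2'⟩ := hloss (k - 1) (by omega) (by omega)
    have h3 : A (k - 1) ≤ A k := hAmono (by omega)
    have h3' : A (k - 1) ^ 2 ≤ A k ^ 2 := pow_le_pow_left₀ (hA _).le h3 2
    have h4 := signLoss_triangle (T k) θ (T (k - 1))
    rw [signLoss_comm θ] at h4
    have h5 : signLoss (T k) (T (k - 1)) ^ 2 ≤
        2 * signLoss (T k) θ ^ 2 + 2 * signLoss (T (k - 1)) θ ^ 2 :=
      (pow_le_pow_left₀ (signLoss_nonneg _ _) h4 2).trans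
        (by nlinarith [sq_nonneg (signLoss (T k) θ - signLoss (T (k - 1)) θ)])
    have h6 : B * A (k - 1) ≤ B * A k := by gcongr
    have h6' : B * A (k - 1) ^ 2 ≤ B * A k ^ 2 := by gcongr
    refine ⟨by linarith, ?_⟩
    have := mul_le_mul_of_nonneg_right h5 (sq_nonneg ‖θ‖)
    linarith
  -- Any proxy `s` for `‖θ‖` whose error is of order `√(A k)` passes the test at `k`; the two steps
  -- apply this with different proxies.
  have hthr : ∀ k s, i₀ + 1 ≤ k → k ≤ M → s ^ 2 ≤ 2 * ‖θ‖ ^ 2 + 2 * B * A k →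
      signLoss (T k) (T (k - 1)) ^ 2 ≤ 4 * C ^ 2 * A k ∧
        signLoss (T k) (T (k - 1)) ^ 2 * s ^ 2 ≤ 4 * C ^ 2 * A k ^ 2 := by
    intro k s hk hkM hs
    obtain ⟨h1, h2⟩ := hstep k hk hkM
    have hAk := hA k
    refine ⟨h1.trans (by gcongr; nlinarith), ?_⟩
    have h3 : signLoss (T k) (T (k - 1)) ^ 2 * s ^ 2 ≤
        signLoss (T k) (T (k - 1)) ^ 2 * (2 * ‖θ‖ ^ 2 + 2 * B * A k) := by gcongr
    have h4 : signLoss (T k) (T (k - 1)) ^ 2 * (2 * B * A k) ≤ 4 * B * A k * (2 * B * A k) := by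
      gcongr
    have h5 : B * A k ^ 2 ≤ B ^ 2 * A k ^ 2 := by gcongr; nlinarith
    have h6 : 16 * B ^ 2 * A k ^ 2 ≤ 4 * C ^ 2 * A k ^ 2 := by gcongr
    linarith [show 4 * B * A k * (2 * B * A k) = 8 * (B ^ 2 * A k ^ 2) by ring]
  have hnorm : ∀ k, i₀ + 1 ≤ k → k ≤ M → ‖T k‖ ^ 2 ≤ 2 * ‖θ‖ ^ 2 + 2 * B * A k := by
    intro k hk hkM
    have h1 := (hloss k (by omega) hkM).1
    have h2 := (abs_le.1 (abs_norm_sub_norm_le_signLoss (T k) θ)).2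
    have h3 : ‖T k‖ ^ 2 ≤ (‖θ‖ + signLoss (T k) θ) ^ 2 :=
      pow_le_pow_left₀ (norm_nonneg _) (by linarith) 2
    linarith [sq_nonneg (‖θ‖ - signLoss (T k) θ),
      show (‖θ‖ + signLoss (T k) θ) ^ 2 + (‖θ‖ - signLoss (T k) θ) ^ 2 =
        2 * ‖θ‖ ^ 2 + 2 * signLoss (T k) θ ^ 2 by ring]
  -- telescoping from an index satisfying the first half of the threshold condition
  have htele : ∀ m i, m ≤ i → i₀ ≤ i → i ≤ M →
      (∀ k, m + 1 ≤ k → k ≤ M → signLoss (T k) (T (k - 1)) ^ 2 ≤ 4 * C ^ 2 * A k) →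
      signLoss (T m) θ ≤ 17 * C * √(A i) := by
    intro m i hmi hi hiM h
    have h1 := signLoss_le_of_geometric (T := T) (r := fun k => 2 * C * √(A k)) hmi (by positivity)
      (fun k => by
        have := mul_le_mul_of_nonneg_left (hbgrow k) (by positivity : 0 ≤ 2 * C)
        linarith)
      (fun k hk hk' => (abs_le_of_sq_le_sq' (by
        have := h k hk (by omega)
        rw [mul_pow, hb2]; linarith) (by positivity)).2)
    have h2 : signLoss (T i) θ ≤ C * √(A i) := by
      refine (abs_le_of_sq_le_sq' ?_ (by positivity)).2
      rw [mul_pow, hb2]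
      refine (hloss i hi hiM).1.trans ?_
      have := (hA i).le
      gcongr
      nlinarith
    linarith [signLoss_triangle (T m) (T i) θ]
  have hm₁i : m₁ ≤ i₀ := hm₁_min i₀ hi₀ fun k hk hkM => hthr k _ hk hkM (hnorm k hk hkM)
  have hs : |‖T m₁‖ - ‖θ‖| ≤ 17 * C * √(A i₀) :=
    (abs_norm_sub_norm_le_signLoss _ _).trans (htele m₁ i₀ hm₁i le_rfl hi₀ hm₁)
  have hs' := abs_le.1 hs
  -- The pilot error is of order `√(A i₀)` with a large constant; past `i₀ + J` it falls below `√(A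
  -- k)`.
  set i₂ := min (i₀ + J) M with hi₂
  have hi₂M : i₂ ≤ M := min_le_right _ _
  have hi₀₂ : i₀ ≤ i₂ := le_min (by omega) hi₀
  have hm₂i : m₂ ≤ i₂ := by
    refine hm₂_min i₂ hi₂M fun k hk hkM => hthr k _ (by omega) hkM ?_
    have hkJ : i₀ + J ≤ k := by
      rcases min_choice (i₀ + J) M with h | h <;> omega
    have hAk : (17 * C) ^ 2 * A i₀ ≤ A k := by
      refine le_trans ?_ (hAmono hkJ)
      refine (abs_le_of_sq_le_sq' ?_ (hA _).le).2
      rw [hApow, mul_pow, ← pow_mul]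
      gcongr
    have h1 : ‖T m₁‖ ^ 2 ≤ (‖θ‖ + 17 * C * √(A i₀)) ^ 2 :=
      pow_le_pow_left₀ (norm_nonneg _) (by linarith) 2
    have h2 : (17 * C * √(A i₀)) ^ 2 ≤ A k := by rwa [mul_pow, hb2]
    have h3 : A k ≤ B * A k := le_mul_of_one_le_left (hA k).le hB
    linarith [sq_nonneg (‖θ‖ - 17 * C * √(A i₀)),
      show (‖θ‖ + 17 * C * √(A i₀)) ^ 2 + (‖θ‖ - 17 * C * √(A i₀)) ^ 2 =
        2 * ‖θ‖ ^ 2 + 2 * (17 * C * √(A i₀)) ^ 2 by ring]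
  have hAi₂ : A i₂ ≤ 2 ^ J * A i₀ := by
    refine (hAmono (min_le_left _ _)).trans ?_
    refine (abs_le_of_sq_le_sq' ?_ (by have := hA i₀; positivity)).2
    rw [hApow, mul_pow]
    gcongr
    exact le_self_pow₀ (one_le_pow₀ (by norm_num)) two_ne_zero
  have hl0 := signLoss_nonneg (T m₂) θ
  have hL : signLoss (T m₂) θ ^ 2 ≤ (17 * C) ^ 2 * 2 ^ J * A i₀ := by
    calc signLoss (T m₂) θ ^ 2 ≤ (17 * C * √(A i₂)) ^ 2 :=
          pow_le_pow_left₀ hl0 (htele m₂ i₂ hm₂i hi₀₂ hi₂M fun k hk hk' => (hm₂ k hk hk').1) 2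
      _ = (17 * C) ^ 2 * A i₂ := by rw [mul_pow, hb2]
      _ ≤ (17 * C) ^ 2 * (2 ^ J * A i₀) := by gcongr
      _ = _ := by ring
  have h2J : (2 : ℝ) ^ J ≤ 4 ^ J := pow_le_pow_left₀ (by norm_num) (by norm_num) J
  have hAi₀ := hA i₀
  have h34 : (1 : ℝ) ≤ 34 * C := by linarith
  refine ⟨hL.trans ?_, ?_⟩
  · calc (17 * C) ^ 2 * 2 ^ J * A i₀ ≤ (34 * C) ^ 2 * 4 ^ J * A i₀ := by gcongr; norm_num
      _ ≤ (34 * C) ^ 4 * 4 ^ J * A i₀ := by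
        gcongr ?_ * _ * _
        exact pow_le_pow_right₀ h34 (by norm_num)
  -- If `‖θ‖` is at least twice the pilot error, the pilot norm can replace it in the thresholds.
  -- Otherwise `‖θ‖²` is of order `A i₀`, and the first bound multiplied by it is the second.
  · rcases le_total (34 * C * √(A i₀)) ‖θ‖ with hθ | hθ
    · have hb0 : 0 < √(A i₀) := Real.sqrt_pos.2 hAi₀
      have hθpos : 0 < ‖θ‖ := lt_of_lt_of_le (by positivity) hθ
      have hsθ : ‖θ‖ / 2 ≤ ‖T m₁‖ := by linarith
      have h1 := signLoss_le_of_geometric (T := T) (r := fun k => 4 * C * A k / ‖θ‖) hm₂i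
        (by have := hA m₂; positivity)
        (fun k => by
          have := mul_le_mul_of_nonneg_left (hAgrow k) (by positivity : 0 ≤ 4 * C / ‖θ‖)
          calc 8 / 7 * (4 * C * A k / ‖θ‖) = 4 * C / ‖θ‖ * (8 / 7 * A k) := by ring
            _ ≤ _ := this
            _ = _ := by ring)
        (fun k hk hk' => by
          rw [le_div_iff₀ hθpos]
          have hk2 := (hm₂ k hk (by omega)).2
          have hx := signLoss_nonneg (T k) (T (k - 1))
          have : signLoss (T k) (T (k - 1)) * ‖T m₁‖ ≤ 2 * C * A k := by
            refine (abs_le_of_sq_le_sq' ?_ (by have := hA k; positivity)).2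
            calc _ = _ := mul_pow _ _ _
              _ ≤ _ := hk2
              _ = _ := by ring
          have := mul_le_mul_of_nonneg_left hsθ hx
          linarith)
      have h2 : signLoss (T i₂) θ * ‖θ‖ ≤ C * A i₂ := by
        refine (abs_le_of_sq_le_sq' ?_ (by have := hA i₂; positivity)).2
        rw [mul_pow, mul_pow]
        refine (hloss i₂ hi₀₂ hi₂M).2.trans ?_
        gcongr
        nlinarith
      have h3 : signLoss (T m₂) θ * ‖θ‖ ≤ 33 * C * A i₂ := by
        have h1' : signLoss (T m₂) (T i₂) * ‖θ‖ ≤ 32 * C * A i₂ := by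
          calc _ ≤ 8 * (4 * C * A i₂ / ‖θ‖) * ‖θ‖ := by gcongr
            _ = _ := by field_simp; ring
        have := mul_le_mul_of_nonneg_right (signLoss_triangle (T m₂) (T i₂) θ) hθ0
        linarith
      calc signLoss (T m₂) θ ^ 2 * ‖θ‖ ^ 2 = (signLoss (T m₂) θ * ‖θ‖) ^ 2 := by ring
        _ ≤ (33 * C * A i₂) ^ 2 := pow_le_pow_left₀ (by positivity) h3 2
        _ ≤ (33 * C * (2 ^ J * A i₀)) ^ 2 := by have := hA i₂; gcongr
        _ = (33 * C) ^ 2 * 4 ^ J * A i₀ ^ 2 := by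
          rw [mul_pow, mul_pow (2 ^ J), ← pow_mul, mul_comm J, pow_mul]; norm_num; ring
        _ ≤ (34 * C) ^ 2 * 4 ^ J * A i₀ ^ 2 := by gcongr; norm_num
        _ ≤ (34 * C) ^ 4 * 4 ^ J * A i₀ ^ 2 := by
          gcongr ?_ * _ * _
          exact pow_le_pow_right₀ h34 (by norm_num)
    · calc signLoss (T m₂) θ ^ 2 * ‖θ‖ ^ 2
          ≤ ((17 * C) ^ 2 * 2 ^ J * A i₀) * (34 * C * √(A i₀)) ^ 2 := by gcongr
        _ = ((17 * C) ^ 2 * 2 ^ J * A i₀) * ((34 * C) ^ 2 * A i₀) := by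
          rw [mul_pow (34 * C), hb2]
        _ ≤ ((34 * C) ^ 2 * 4 ^ J * A i₀) * ((34 * C) ^ 2 * A i₀) := by gcongr; norm_num
        _ = _ := by ring

/-! ### The number of flips of the chain -/

/-- The path of signs coded by a Boolean path. -/
def signPath {n : ℕ} (b : Fin n → Bool) (i : Fin n) : ℝ := if b i then 1 else -1

lemma signPath_eq_or {n : ℕ} (b : Fin n → Bool) (i : Fin n) :
    signPath b i = 1 ∨ signPath b i = -1 := by
  unfold signPath; split_ifs <;> simp

lemma signPath_eq_iff {n : ℕ} (b : Fin n → Bool) (i j : Fin n) :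
    signPath b i = signPath b j ↔ b i = b j := by
  unfold signPath
  cases b i <;> cases b j <;> norm_num

lemma signPath_injective {n : ℕ} : Function.Injective (signPath (n := n)) := by
  intro b b' h
  funext i
  have := congrFun h i
  unfold signPath at this
  revert this
  cases b i <;> cases b' i <;> norm_num

/-- The times `i` at which a path moves to a different state. -/
def flipSet {n : ℕ} (b : Fin n → Bool) : Finset (Fin n) :=
  Finset.univ.filter fun i => ∃ h : (i : ℕ) + 1 < n, b ⟨i + 1, h⟩ ≠ b i

/-- The product of `p` over the steps without a flip and `q` over the flips. -/
noncomputable def stepProd (p q : ℝ) {n : ℕ} (b : Fin n → Bool) : ℝ :=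
  ∏ i : Fin n, if h : (i : ℕ) + 1 < n then (if b ⟨i + 1, h⟩ = b i then p else q) else 1

lemma stepProd_cons (p q : ℝ) {n : ℕ} (x : Bool) (b : Fin (n + 1) → Bool) :
    stepProd p q (Fin.cons x b : Fin (n + 2) → Bool) = (if b 0 = x then p else q) * stepProd p q b := by
  unfold stepProd
  rw [Fin.prod_univ_succ]
  congr 1
  refine Finset.prod_congr rfl fun i _ => ?_
  by_cases h : (i : ℕ) + 1 < n + 1
  · have h' : ((Fin.succ i : Fin (n + 2)) : ℕ) + 1 < n + 2 := by simpa using h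
    rw [dif_pos h, dif_pos h']
    have : (⟨(Fin.succ i : Fin (n + 2)) + 1, h'⟩ : Fin (n + 2)) = Fin.succ ⟨i + 1, h⟩ := by
      ext; simp
    rw [this, Fin.cons_succ, Fin.cons_succ]
  · have h' : ¬ ((Fin.succ i : Fin (n + 2)) : ℕ) + 1 < n + 2 := by simpa using h
    rw [dif_neg h, dif_neg h']

/-- Whatever the second state, summing over the first state gives a factor `p + q`; the `2` counts
the states of a path of length one. -/
lemma sum_stepProd (p q : ℝ) (n : ℕ) :
    ∑ b : Fin (n + 1) → Bool, stepProd p q b = 2 * (p + q) ^ n := by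
  induction n with
  | zero => simp [stepProd]
  | succ n ih =>
    rw [← (Fin.consEquiv fun _ => Bool).sum_comp, Fintype.sum_prod_type, Finset.sum_comm]
    have : ∀ b : Fin (n + 1) → Bool, ∑ x : Bool,
        stepProd p q ((Fin.consEquiv fun _ : Fin (n + 2) => Bool) (x, b)) =
          (p + q) * stepProd p q b := by
      intro b
      have hx : ∀ x, (Fin.consEquiv fun _ : Fin (n + 2) => Bool) (x, b) = Fin.cons x b :=
        fun _ => rfl
      simp only [hx, stepProd_cons, Fintype.sum_bool]
      cases b 0 <;> simp <;> ring
    rw [Finset.sum_congr rfl fun b _ => this b, ← Finset.mul_sum, ih]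
    ring

/-- Exponential tilting by the number of flips only changes the flip weight, so the generating
function of that number is another instance of `sum_stepProd`. -/
lemma stepProd_mul_pow_card (p q r : ℝ) {n : ℕ} (b : Fin n → Bool) :
    stepProd p q b * r ^ (flipSet b).card = stepProd p (q * r) b := by
  unfold stepProd flipSet
  rw [← Finset.prod_const, Finset.prod_filter, ← Finset.prod_mul_distrib]
  refine Finset.prod_congr rfl fun i _ => ?_
  by_cases h : (i : ℕ) + 1 < n
  · by_cases h' : b ⟨i + 1, h⟩ = b i <;> simp [h, h']
  · simp [h]

lemma IsSignChain.measure_path {Ω : Type*} [MeasurableSpace Ω] {P : Measure Ω} {n : ℕ} {δ : ℝ}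
    {η : Fin n → Ω → ℝ} (hη : IsSignChain P δ η) (b : Fin n → Bool) :
    P {ω | ∀ i, η i ω = signPath b i} = ENNReal.ofReal (1 / 2 * stepProd (1 - δ) δ b) := by
  rw [hη.path_law _ (signPath_eq_or b)]
  simp only [signPath_eq_iff]
  rfl

lemma stepProd_nonneg {p q : ℝ} (hp : 0 ≤ p) (hq : 0 ≤ q) {n : ℕ} (b : Fin n → Bool) :
    0 ≤ stepProd p q b := by
  refine Finset.prod_nonneg fun i _ => ?_
  split_ifs <;> simp [hp, hq]

/-- The path weights sum to `1`, so no mass is left outside the sign paths. -/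
lemma IsSignChain.measure_not_exists_path {Ω : Type*} [MeasurableSpace Ω] {P : Measure Ω}
    [IsProbabilityMeasure P] {n : ℕ} {δ : ℝ} (hn : 1 ≤ n) (hδ : 0 ≤ δ) (hδ' : δ ≤ 1)
    {η : Fin n → Ω → ℝ} (hη : IsSignChain P δ η) :
    P {ω | ¬ ∃ b, ∀ i, η i ω = signPath b i} = 0 := by
  obtain ⟨m, rfl⟩ : ∃ m, n = m + 1 := ⟨n - 1, by omega⟩
  have hmeas : ∀ b, MeasurableSet {ω | ∀ i, η i ω = signPath b i} := fun b => by
    rw [Set.ofPred_forall]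
    exact MeasurableSet.iInter fun i => hη.measurable i (measurableSet_singleton _)
  have hset : {ω | ∃ b, ∀ i, η i ω = signPath b i} = ⋃ b, {ω | ∀ i, η i ω = signPath b i} := by
    ext; simp
  have h1 : P {ω | ∃ b, ∀ i, η i ω = signPath b i} = 1 := by
    rw [hset, measure_iUnion _ hmeas, tsum_fintype]
    · simp_rw [hη.measure_path]
      rw [← ENNReal.ofReal_sum_of_nonneg, ← Finset.mul_sum, sum_stepProd]
      · simp
      · intro b _
        have := stepProd_nonneg (by linarith : 0 ≤ 1 - δ) hδ b
        positivity
    · intro b b' hbb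
      refine Set.disjoint_left.2 fun ω h h' => hbb (signPath_injective ?_)
      funext i
      exact (h i).symm.trans (h' i)
  have hm : MeasurableSet {ω | ∃ b, ∀ i, η i ω = signPath b i} := by
    rw [hset]; exact MeasurableSet.iUnion hmeas
  have := prob_compl_eq_zero_iff (μ := P) hm |>.2 h1
  rwa [Set.compl_ofPred] at this

/-- Chernoff with parameter `1`: `1 - δ + δe ≤ 1 + 2δ ≤ exp (2δ)` accounts for the centring `2nδ`,
and the slack `d` remains in the exponent. -/
lemma IsSignChain.measure_flips_gt_le {Ω : Type*} [MeasurableSpace Ω] {P : Measure Ω}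
    [IsProbabilityMeasure P] {n d : ℕ} {δ : ℝ} (hn : 1 ≤ n) (hδ : 0 ≤ δ) (hδ' : δ ≤ 1)
    {η : Fin n → Ω → ℝ} (hη : IsSignChain P δ η) :
    P {ω | ¬ ∃ b, (∀ i, η i ω = signPath b i) ∧ ((flipSet b).card : ℝ) ≤ 2 * n * δ + d} ≤
      ENNReal.ofReal (Real.exp (-d)) := by
  set τ : ℝ := 2 * n * δ + d with hτ
  have hsub : {ω | ¬ ∃ b, (∀ i, η i ω = signPath b i) ∧ ((flipSet b).card : ℝ) ≤ τ} ⊆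
      {ω | ¬ ∃ b, ∀ i, η i ω = signPath b i} ∪
        ⋃ b ∈ Finset.univ.filter fun b : Fin n → Bool => τ < (flipSet b).card,
          {ω | ∀ i, η i ω = signPath b i} := by
    intro ω hω
    by_cases h : ∃ b, ∀ i, η i ω = signPath b i
    · right
      obtain ⟨b, hb⟩ := h
      simp only [Set.mem_iUnion]
      refine ⟨b, ?_, hb⟩
      rw [Finset.mem_filter]
      refine ⟨Finset.mem_univ _, ?_⟩
      by_contra hc
      exact hω ⟨b, hb, not_lt.1 hc⟩
    · exact Or.inl h
  refine (measure_mono hsub).trans ((measure_union_le _ _).trans ?_)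
  rw [hη.measure_not_exists_path hn hδ hδ', zero_add]
  refine (measure_biUnion_finset_le _ _).trans ?_
  have hw : ∀ b : Fin n → Bool, 0 ≤ stepProd (1 - δ) δ b :=
    fun b => stepProd_nonneg (by linarith) hδ b
  calc ∑ b ∈ Finset.univ.filter fun b : Fin n → Bool => τ < (flipSet b).card,
        P {ω | ∀ i, η i ω = signPath b i}
      ≤ ∑ b ∈ Finset.univ.filter fun b : Fin n → Bool => τ < (flipSet b).card,
        ENNReal.ofReal (Real.exp (-τ) * (1 / 2 * stepProd (1 - δ) (δ * Real.exp 1) b)) := by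
        refine Finset.sum_le_sum fun b hb => ?_
        rw [hη.measure_path]
        refine ENNReal.ofReal_le_ofReal ?_
        rw [← stepProd_mul_pow_card, ← Real.exp_nat_mul, mul_one]
        have h1 : 1 ≤ Real.exp (-τ) * Real.exp ((flipSet b).card : ℝ) := by
          rw [← Real.exp_add]
          exact Real.one_le_exp (by linarith [(Finset.mem_filter.1 hb).2])
        have h2 := hw b
        calc 1 / 2 * stepProd (1 - δ) δ b ≤ 1 / 2 * stepProd (1 - δ) δ b *
              (Real.exp (-τ) * Real.exp ((flipSet b).card : ℝ)) :=
              le_mul_of_one_le_right (by positivity) h1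
          _ = _ := by ring
    _ ≤ ∑ b : Fin n → Bool,
        ENNReal.ofReal (Real.exp (-τ) * (1 / 2 * stepProd (1 - δ) (δ * Real.exp 1) b)) :=
        Finset.sum_le_univ_sum_of_nonneg fun _ => zero_le
    _ = ENNReal.ofReal (Real.exp (-τ) * (1 / 2 *
          ∑ b : Fin n → Bool, stepProd (1 - δ) (δ * Real.exp 1) b)) := by
        rw [← ENNReal.ofReal_sum_of_nonneg, Finset.mul_sum, Finset.mul_sum]
        intro b _
        have := stepProd_nonneg (by linarith : 0 ≤ 1 - δ) (by positivity : 0 ≤ δ * Real.exp 1) b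
        positivity
    _ ≤ ENNReal.ofReal (Real.exp (-d)) := by
        refine ENNReal.ofReal_le_ofReal ?_
        obtain ⟨m, rfl⟩ : ∃ m, n = m + 1 := ⟨n - 1, by omega⟩
        rw [sum_stepProd]
        have he : Real.exp 1 ≤ 3 := by linarith [Real.exp_one_lt_d9]
        have h1 : (1 - δ + δ * Real.exp 1) ≤ Real.exp (2 * δ) := by
          nlinarith [Real.add_one_le_exp (2 * δ)]
        have h2 : (1 - δ + δ * Real.exp 1) ^ m ≤ Real.exp (2 * δ) ^ m :=
          pow_le_pow_left₀ (by have : 0 ≤ δ * Real.exp 1 := by positivity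
                               linarith) h1 m
        rw [← Real.exp_nat_mul] at h2
        calc Real.exp (-τ) * (1 / 2 * (2 * (1 - δ + δ * Real.exp 1) ^ m))
            = Real.exp (-τ) * (1 - δ + δ * Real.exp 1) ^ m := by ring
          _ ≤ Real.exp (-τ) * Real.exp (m * (2 * δ)) := by gcongr
          _ = Real.exp (-τ + m * (2 * δ)) := (Real.exp_add _ _).symm
          _ ≤ Real.exp (-d) := by
            refine Real.exp_le_exp.2 ?_
            rw [hτ]; push_cast; linarith

/-! ### Buckets -/

lemma mem_bucket {n l : ℕ} {i : Fin l} {j : Fin n} : j ∈ bucket n l i ↔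
    (i : ℕ) * bucketLen n l ≤ (j : ℕ) ∧ (j : ℕ) < ((i : ℕ) + 1) * bucketLen n l := by
  simp [bucket]

lemma bucket_disjoint {n l : ℕ} {i i' : Fin l} (h : i ≠ i') :
    Disjoint (bucket n l i) (bucket n l i') := by
  have key : ∀ i i' : Fin l, i < i' → Disjoint (bucket n l i) (bucket n l i') := by
    intro i i' h
    refine Finset.disjoint_left.2 fun j hj hj' => ?_
    rw [mem_bucket] at hj hj'
    have : ((i : ℕ) + 1) * bucketLen n l ≤ (i' : ℕ) * bucketLen n l :=
      Nat.mul_le_mul_right _ h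
    omega
  rcases lt_or_gt_of_ne h with h | h
  · exact key _ _ h
  · exact (key _ _ h).symm

lemma card_bucket {n l : ℕ} (i : Fin l) : (bucket n l i).card = bucketLen n l := by
  have hle : ((i : ℕ) + 1) * bucketLen n l ≤ n := by
    calc ((i : ℕ) + 1) * bucketLen n l ≤ l * (n / l) := Nat.mul_le_mul_right _ i.2
      _ ≤ n := Nat.mul_div_le n l
  have : (bucket n l i).map Fin.valEmbedding =
      Finset.Ico ((i : ℕ) * bucketLen n l) (((i : ℕ) + 1) * bucketLen n l) := by
    ext j
    simp only [Finset.mem_map, mem_bucket, Fin.valEmbedding_apply, Finset.mem_Ico]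
    constructor
    · rintro ⟨j, h, rfl⟩; exact h
    · intro h; exact ⟨⟨j, by omega⟩, h, rfl⟩
  rw [← Finset.card_map Fin.valEmbedding, this, Nat.card_Ico, Nat.add_mul, one_mul,
    Nat.add_sub_cancel_left]

lemma bucketLen_pos {n l : ℕ} (hl : 1 ≤ l) (hln : l ≤ n) : 0 < bucketLen n l :=
  Nat.div_pos hln hl

/-- The dropped remainder is smaller than `l`, hence than the part that is kept. -/
lemma le_two_mul_bucketLen_mul {n l : ℕ} (hl : 1 ≤ l) (hln : l ≤ n) :
    (n : ℝ) ≤ 2 * ((bucketLen n l : ℝ) * l) := by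
  have h1 := Nat.div_add_mod n l
  have h2 := Nat.mod_lt n hl
  have h3 : l * 1 ≤ l * (n / l) := Nat.mul_le_mul_left _ (bucketLen_pos hl hln)
  have : n ≤ 2 * (bucketLen n l * l) := by
    unfold bucketLen
    rw [mul_comm (n / l) l]; omega
  exact_mod_cast this

/-- The mean of a real sequence over the `i`-th bucket. -/
noncomputable def bucketAvg {n : ℕ} (e : Fin n → ℝ) (l : ℕ) (i : Fin l) : ℝ :=
  1 / (bucketLen n l : ℝ) * ∑ j ∈ bucket n l i, e j

lemma abs_bucketAvg_le {n l : ℕ} {e : Fin n → ℝ} (he : ∀ j, |e j| ≤ 1) (i : Fin l) :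
    |bucketAvg e l i| ≤ 1 := by
  unfold bucketAvg
  rcases Nat.eq_zero_or_pos (bucketLen n l) with h | h
  · simp [h]
  · have h' : (0 : ℝ) < bucketLen n l := by exact_mod_cast h
    rw [abs_mul, abs_of_pos (by positivity), one_div, inv_mul_le_iff₀ h', mul_one]
    calc |∑ j ∈ bucket n l i, e j| ≤ ∑ j ∈ bucket n l i, |e j| := Finset.abs_sum_le_sum_abs _ _
      _ ≤ ∑ j ∈ bucket n l i, 1 := Finset.sum_le_sum fun j _ => he j
      _ = bucketLen n l := by simp [card_bucket]

lemma abs_signPath_le {n : ℕ} (b : Fin n → Bool) (j : Fin n) : |signPath b j| ≤ 1 := by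
  rcases signPath_eq_or b j with h | h <;> simp [h]

/-- A bucket without flips is constant, so its average is `±1`; otherwise the right side is at least
`1`. A flip out of the last index of a bucket is also counted, which is harmless. -/
lemma one_sub_bucketAvg_sq_le {n l : ℕ} (hl : 1 ≤ l) (hln : l ≤ n) (b : Fin n → Bool) (i : Fin l) :
    1 - bucketAvg (signPath b) l i ^ 2 ≤ ((flipSet b ∩ bucket n l i).card : ℝ) := by
  have hk := bucketLen_pos hl hln
  by_cases h : (flipSet b ∩ bucket n l i).card = 0
  · rw [h, Nat.cast_zero]
    rw [Finset.card_eq_zero] at h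
    have hle : ((i : ℕ) + 1) * bucketLen n l ≤ n := by
      calc ((i : ℕ) + 1) * bucketLen n l ≤ l * (n / l) := Nat.mul_le_mul_right _ i.2
        _ ≤ n := Nat.mul_div_le n l
    have hlt : (i : ℕ) * bucketLen n l < n := by
      rw [Nat.add_mul] at hle; omega
    set j₀ : Fin n := ⟨(i : ℕ) * bucketLen n l, hlt⟩ with hj₀
    have hconst : ∀ m, ∀ hm : (i : ℕ) * bucketLen n l + m < n, m < bucketLen n l →
        b ⟨(i : ℕ) * bucketLen n l + m, hm⟩ = b j₀ := by
      intro m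
      induction m with
      | zero => intro _ _; rfl
      | succ m ih =>
        intro hm hmk
        rw [← ih (by omega) (by omega)]
        by_contra hne
        have hmem : (⟨(i : ℕ) * bucketLen n l + m, by omega⟩ : Fin n) ∈
            flipSet b ∩ bucket n l i := by
          rw [Finset.mem_inter, mem_bucket]
          refine ⟨?_, by simp, by simp only [Nat.add_mul]; omega⟩
          simp only [flipSet, Finset.mem_filter, Finset.mem_univ, true_and]
          exact ⟨hm, hne⟩
        rw [h] at hmem
        simp at hmem
    have hall : ∀ j ∈ bucket n l i, signPath b j = signPath b j₀ := by
      intro j hj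
      rw [signPath_eq_iff]
      rw [mem_bucket, Nat.add_mul] at hj
      have := hconst (j - (i : ℕ) * bucketLen n l) (by omega) (by omega)
      rw [← this]
      congr 1
      ext; simp only; omega
    have hk' : (bucketLen n l : ℝ) ≠ 0 := by exact_mod_cast hk.ne'
    have : bucketAvg (signPath b) l i = signPath b j₀ := by
      rw [bucketAvg, Finset.sum_congr rfl hall, Finset.sum_const, card_bucket, nsmul_eq_mul]
      field_simp
    rw [this]
    rcases signPath_eq_or b j₀ with h | h <;> simp [h]
  · have h1 : (1 : ℝ) ≤ ((flipSet b ∩ bucket n l i).card : ℝ) := by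
      exact_mod_cast Nat.one_le_iff_ne_zero.2 h
    linarith [sq_nonneg (bucketAvg (signPath b) l i)]

lemma sum_one_sub_bucketAvg_sq_le {n l : ℕ} (hl : 1 ≤ l) (hln : l ≤ n) (b : Fin n → Bool) :
    ∑ i : Fin l, (1 - bucketAvg (signPath b) l i ^ 2) ≤ ((flipSet b).card : ℝ) := by
  refine (Finset.sum_le_sum fun i _ => one_sub_bucketAvg_sq_le hl hln b i).trans ?_
  rw [← Nat.cast_sum, ← Finset.card_biUnion, ← Finset.inter_biUnion]
  · exact_mod_cast Finset.card_le_card Finset.inter_subset_left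
  · intro i _ i' _ h
    exact (bucket_disjoint h).mono Finset.inter_subset_right Finset.inter_subset_right

/-! ### Sub-Gaussian variables and Bernstein bounds for their products -/

section SubGaussian

variable {Ω : Type*} [MeasurableSpace Ω] {P : Measure Ω}

open scoped NNReal

lemma integrable_mul_of_hasSubgaussianMGF {X Y : Ω → ℝ} {c c' : ℝ≥0}
    (hX : HasSubgaussianMGF X c P) (hY : HasSubgaussianMGF Y c' P) :
    Integrable (fun ω => X ω * Y ω) P := by
  have hX2 : MemLp X 2 P := by simpa using hX.memLp 2
  have hY2 : MemLp Y 2 P := by simpa using hY.memLp 2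
  exact hX2.integrable_mul hY2

variable [IsProbabilityMeasure P]

/-- The gap between the sub-Gaussian bound and `1 + t m` is nonnegative and vanishes at `t = 0`, so
its derivative `-m` is zero there. This centres the noise, whose mean is not prescribed. -/
lemma integral_eq_zero_of_hasSubgaussianMGF {X : Ω → ℝ} {c : ℝ≥0}
    (hX : HasSubgaussianMGF X c P) : ∫ ω, X ω ∂P = 0 := by
  set m := ∫ ω, X ω ∂P with hm
  set φ : ℝ → ℝ := fun t => Real.exp (c * t ^ 2 / 2) - 1 - t * m with hφ
  have h0 : φ 0 = 0 := by simp [hφ]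
  have hpos : ∀ t, 0 ≤ φ t := by
    intro t
    have h1 : ∫ ω, (1 + t * X ω) ∂P ≤ mgf X P t :=
      integral_mono ((integrable_const _).add (hX.integrable.const_mul t))
        (hX.integrable_exp_mul t) fun ω => by
          have := Real.add_one_le_exp (t * X ω)
          simp only
          linarith
    rw [integral_add (integrable_const _) (hX.integrable.const_mul t), integral_const_mul] at h1
    have h2 := hX.mgf_le t
    simp only [integral_const, probReal_univ, smul_eq_mul, one_mul] at h1
    simp only [hφ]
    linarith
  have hmin : IsLocalMin φ 0 := Filter.Eventually.of_forall fun t => by rw [h0]; exact hpos t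
  have hderiv : HasDerivAt φ (-m) 0 := by
    have h1 : HasDerivAt (fun t : ℝ => (c : ℝ) * t ^ 2 / 2) 0 0 := by
      have := (((hasDerivAt_id (0 : ℝ)).pow 2).const_mul (c : ℝ)).div_const 2
      simpa using this
    have h2 : HasDerivAt φ (Real.exp ((c : ℝ) * 0 ^ 2 / 2) * 0 - 1 * m) 0 :=
      (h1.exp.sub_const 1).sub ((hasDerivAt_id (0 : ℝ)).mul_const m)
    simpa using h2
  have := hmin.hasDerivAt_eq_zero hderiv
  linarith

/-! ### Exponential moments of squares and products of sub-Gaussian variables. -/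

lemma lintegral_exp_mul_gaussianReal (x : ℝ) :
    ∫⁻ g, ENNReal.ofReal (Real.exp (x * g)) ∂(gaussianReal 0 (1 / 8)) =
      ENNReal.ofReal (Real.exp (x ^ 2 / 16)) := by
  have hint := integrable_exp_mul_gaussianReal (μ := 0) (v := 1 / 8) x
  rw [← ofReal_integral_eq_lintegral_ofReal hint (Filter.Eventually.of_forall fun g => by positivity)]
  congr 1
  have := congrFun (mgf_id_gaussianReal (μ := 0) (v := 1 / 8)) x
  simp only [mgf, id] at this
  rw [this]
  congr 1
  push_cast
  ring

lemma lintegral_exp_sq_gaussianReal_le :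
    ∫⁻ g, ENNReal.ofReal (Real.exp (2 * g ^ 2)) ∂(gaussianReal 0 (1 / 8)) ≤ ENNReal.ofReal 2 := by
  rw [gaussianReal_of_var_ne_zero _ (by norm_num),
    lintegral_withDensity_eq_lintegral_mul _ (measurable_gaussianPDF _ _) (by fun_prop)]
  have : ∀ g : ℝ, (gaussianPDF 0 (1 / 8) * fun g => ENNReal.ofReal (Real.exp (2 * g ^ 2))) g =
      ENNReal.ofReal ((√(2 * Real.pi * (1 / 8)))⁻¹ * Real.exp (-2 * g ^ 2)) := by
    intro g
    simp only [Pi.mul_apply, gaussianPDF]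
    rw [← ENNReal.ofReal_mul (gaussianPDFReal_nonneg _ _ _)]
    congr 1
    simp only [gaussianPDFReal]
    push_cast
    rw [mul_assoc, ← Real.exp_add]
    congr 2
    ring
  rw [lintegral_congr this, ← ofReal_integral_eq_lintegral_ofReal
    ((integrable_exp_neg_mul_sq (by norm_num : (0 : ℝ) < 2)).const_mul _)
    (Filter.Eventually.of_forall fun g => by positivity)]
  refine ENNReal.ofReal_le_ofReal ?_
  rw [integral_const_mul, integral_gaussian, ← Real.sqrt_inv, ← Real.sqrt_mul (by positivity)]
  have : (2 * Real.pi * (1 / 8))⁻¹ * (Real.pi / 2) = 2 := by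
    have := Real.pi_pos
    field_simp; norm_num
  rw [this]
  exact Real.sqrt_le_iff.2 ⟨by norm_num, by norm_num⟩

/-- Linearize the square with an independent Gaussian `g` of variance `1/8`: `exp (X²/16)` is the
mean of `exp (X g)` over `g`. Exchanging the integrals leaves the mean of `exp (2g²)`, which is
`√2`. -/
lemma lintegral_exp_sq_le {X : Ω → ℝ} (hXm : Measurable X) (hX : HasSubgaussianMGF X 4 P) :
    ∫⁻ ω, ENNReal.ofReal (Real.exp (X ω ^ 2 / 16)) ∂P ≤ ENNReal.ofReal 2 := by
  calc ∫⁻ ω, ENNReal.ofReal (Real.exp (X ω ^ 2 / 16)) ∂P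
      = ∫⁻ ω, ∫⁻ g, ENNReal.ofReal (Real.exp (X ω * g)) ∂(gaussianReal 0 (1 / 8)) ∂P := by
        simp_rw [lintegral_exp_mul_gaussianReal]
    _ = ∫⁻ g, ∫⁻ ω, ENNReal.ofReal (Real.exp (X ω * g)) ∂P ∂(gaussianReal 0 (1 / 8)) := by
        refine lintegral_lintegral_swap (Measurable.aemeasurable ?_)
        fun_prop
    _ ≤ ∫⁻ g, ENNReal.ofReal (Real.exp (2 * g ^ 2)) ∂(gaussianReal 0 (1 / 8)) := by
        refine lintegral_mono fun g => ?_
        have hint := hX.integrable_exp_mul g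
        have hle := hX.mgf_le g
        simp only [mgf] at hle
        simp_rw [mul_comm _ g]
        rw [← ofReal_integral_eq_lintegral_ofReal hint
          (Filter.Eventually.of_forall fun ω => by positivity)]
        refine ENNReal.ofReal_le_ofReal (hle.trans (Real.exp_le_exp.2 ?_))
        push_cast; linarith
    _ ≤ _ := lintegral_exp_sq_gaussianReal_le

lemma integrable_exp_sq {X : Ω → ℝ} (hXm : Measurable X) (hX : HasSubgaussianMGF X 4 P) :
    Integrable (fun ω => Real.exp (X ω ^ 2 / 16)) P ∧ ∫ ω, Real.exp (X ω ^ 2 / 16) ∂P ≤ 2 := by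
  have h := lintegral_exp_sq_le hXm hX
  have hm : Measurable fun ω => Real.exp (X ω ^ 2 / 16) := by fun_prop
  have hnn : ∀ ω, 0 ≤ Real.exp (X ω ^ 2 / 16) := fun ω => by positivity
  refine ⟨⟨hm.aestronglyMeasurable, ?_⟩, ?_⟩
  · rw [hasFiniteIntegral_iff_ofReal (Filter.Eventually.of_forall hnn)]
    exact h.trans_lt ENNReal.ofReal_lt_top
  · rw [integral_eq_lintegral_of_nonneg_ae (Filter.Eventually.of_forall hnn)
      hm.aestronglyMeasurable]
    exact ENNReal.toReal_le_of_le_ofReal (by norm_num) h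

lemma exp_le_one_add_add_sq_mul (y : ℝ) : Real.exp y ≤ 1 + y + y ^ 2 * Real.exp |y| := by
  have h1 : 1 ≤ Real.exp |y| := Real.one_le_exp (abs_nonneg y)
  rcases le_or_gt |y| 1 with h | h
  · have := (abs_le.1 (Real.abs_exp_sub_one_sub_id_le h)).2
    nlinarith [sq_nonneg y]
  · rcases le_total 0 y with hy | hy
    · rw [abs_of_nonneg hy] at h ⊢
      have : Real.exp y ≤ y ^ 2 * Real.exp y :=
        le_mul_of_one_le_left (Real.exp_pos y).le (by nlinarith)
      linarith
    · have h2 := Real.exp_le_one_iff.2 hy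
      rw [abs_of_nonpos hy] at h h1 ⊢
      nlinarith [Real.exp_pos (-y)]

/-- A second-order expansion whose remainder is integrable uniformly in `s`; `2048 = 2 · 32²` comes
from `x²/2 ≤ exp x` at `x = |w|/32`. -/
lemma exp_mul_le_of_abs_le {s w : ℝ} (hs : |s| ≤ 1 / 32) :
    Real.exp (s * w) ≤ 1 + s * w + 2048 * s ^ 2 * Real.exp (|w| / 16) := by
  have h1 := exp_le_one_add_add_sq_mul (s * w)
  have h2 : |s * w| ≤ |w| / 32 := by
    rw [abs_mul]; nlinarith [abs_nonneg w]
  have h3 : w ^ 2 ≤ 2048 * Real.exp (|w| / 32) := by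
    have := Real.quadratic_le_exp_of_nonneg (x := |w| / 32) (by positivity)
    have h4 : w ^ 2 = |w| ^ 2 := (sq_abs w).symm
    nlinarith [abs_nonneg w]
  have h4 : (s * w) ^ 2 * Real.exp |s * w| ≤ 2048 * s ^ 2 * Real.exp (|w| / 16) := by
    calc (s * w) ^ 2 * Real.exp |s * w| = s ^ 2 * w ^ 2 * Real.exp |s * w| := by ring
      _ ≤ s ^ 2 * (2048 * Real.exp (|w| / 32)) * Real.exp (|w| / 32) := by gcongr
      _ = 2048 * s ^ 2 * (Real.exp (|w| / 32) * Real.exp (|w| / 32)) := by ring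
      _ = _ := by rw [← Real.exp_add]; congr 2; ring
  linarith

lemma integrable_exp_mul_product {X Y : Ω → ℝ} {m : ℝ} (hXm : Measurable X) (hYm : Measurable Y)
    (hX : HasSubgaussianMGF X 4 P) (hY : HasSubgaussianMGF Y 4 P)
    (hm : ∫ ω, X ω * Y ω ∂P = m) (hm4 : |m| ≤ 4) {s : ℝ} (hs : |s| ≤ 1 / 32) :
    Integrable (fun ω => Real.exp (s * (X ω * Y ω - m))) P ∧
      mgf (fun ω => X ω * Y ω - m) P s ≤ Real.exp (6144 * s ^ 2) := by
  obtain ⟨hX1, hX2⟩ := integrable_exp_sq hXm hX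
  obtain ⟨hY1, hY2⟩ := integrable_exp_sq hYm hY
  have hXY : Integrable (fun ω => X ω * Y ω) P :=
    integrable_mul_of_hasSubgaussianMGF hX hY
  have hW : Integrable (fun ω => X ω * Y ω - m) P := hXY.sub (integrable_const m)
  have hL : Integrable (fun ω => 1 + s * (X ω * Y ω - m)) P :=
    (integrable_const _).add (hW.const_mul s)
  have hW0 : ∫ ω, (X ω * Y ω - m) ∂P = 0 := by
    rw [integral_sub hXY (integrable_const m), hm]; simp
  -- Arithmetic-geometric mean twice, in the exponent and for the exponentials; `3/4 = (3/2)/2` with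
  -- `exp (1/4) ≤ 3/2`. Integrated, it gives `3`, whence `6144 = 3 · 2048`.
  have hdom : ∀ ω, Real.exp (|X ω * Y ω - m| / 16) ≤
      3 / 4 * (Real.exp (X ω ^ 2 / 16) + Real.exp (Y ω ^ 2 / 16)) := by
    intro ω
    set a := X ω
    set b := Y ω
    have h1 : |a * b - m| ≤ (a ^ 2 + b ^ 2) / 2 + 4 := by
      refine (abs_sub _ _).trans (add_le_add ?_ hm4)
      rw [abs_le]
      constructor <;> nlinarith [sq_nonneg (a + b), sq_nonneg (a - b)]
    have h2 : Real.exp (1 / 4) ≤ 3 / 2 := by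
      have h := Real.abs_exp_sub_one_sub_id_le (x := 1 / 4) (by norm_num [abs_le])
      linarith [(abs_le.1 h).2]
    set u := Real.exp (a ^ 2 / 32) with hu
    set v := Real.exp (b ^ 2 / 32) with hv
    have hu2 : Real.exp (a ^ 2 / 16) = u ^ 2 := by rw [hu, ← Real.exp_nat_mul]; congr 1; push_cast; ring
    have hv2 : Real.exp (b ^ 2 / 16) = v ^ 2 := by rw [hv, ← Real.exp_nat_mul]; congr 1; push_cast; ring
    have hu0 : 0 < u := Real.exp_pos _
    have hv0 : 0 < v := Real.exp_pos _
    calc Real.exp (|a * b - m| / 16) ≤ Real.exp (1 / 4 + (a ^ 2 / 32 + b ^ 2 / 32)) :=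
          Real.exp_le_exp.2 (by linarith)
      _ = Real.exp (1 / 4) * (u * v) := by rw [Real.exp_add, Real.exp_add]
      _ ≤ 3 / 2 * (u * v) := by gcongr
      _ ≤ _ := by rw [hu2, hv2]; nlinarith [sq_nonneg (u - v)]
  have hdomint : Integrable
      (fun ω => 3 / 4 * (Real.exp (X ω ^ 2 / 16) + Real.exp (Y ω ^ 2 / 16))) P :=
    (hX1.add hY1).const_mul _
  have hI : Integrable (fun ω => Real.exp (|X ω * Y ω - m| / 16)) P :=
    hdomint.mono' (by fun_prop) (Filter.Eventually.of_forall fun ω => by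
      rw [Real.norm_eq_abs, abs_of_pos (Real.exp_pos _)]; exact hdom ω)
  have hI3 : ∫ ω, Real.exp (|X ω * Y ω - m| / 16) ∂P ≤ 3 := by
    refine (integral_mono hI hdomint hdom).trans ?_
    rw [integral_const_mul, integral_add hX1 hY1]
    linarith
  have hE : Integrable (fun ω => Real.exp (s * (X ω * Y ω - m))) P := by
    refine hI.mono' (by fun_prop) (Filter.Eventually.of_forall fun ω => ?_)
    rw [Real.norm_eq_abs, abs_of_pos (Real.exp_pos _)]
    refine Real.exp_le_exp.2 ((le_abs_self _).trans ?_)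
    rw [abs_mul]
    nlinarith [abs_nonneg (X ω * Y ω - m)]
  refine ⟨hE, ?_⟩
  calc mgf (fun ω => X ω * Y ω - m) P s
      ≤ ∫ ω, ((1 + s * (X ω * Y ω - m)) + 2048 * s ^ 2 * Real.exp (|X ω * Y ω - m| / 16)) ∂P :=
        integral_mono hE (hL.add (hI.const_mul _))
          fun ω => exp_mul_le_of_abs_le hs
    _ = 1 + 2048 * s ^ 2 * ∫ ω, Real.exp (|X ω * Y ω - m| / 16) ∂P := by
        rw [integral_add hL (hI.const_mul _),
          integral_add (integrable_const _) (hW.const_mul s), integral_const_mul,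
          integral_const_mul, hW0]
        simp
    _ ≤ 1 + 2048 * s ^ 2 * 3 := by gcongr
    _ ≤ _ := by linarith [Real.add_one_le_exp (6144 * s ^ 2)]

/-- Bernstein's inequality for sums of independent products of sub-Gaussian variables. -/
lemma measure_sum_product_ge_le {l : ℕ} {X Y : Fin l → Ω → ℝ} {m : ℝ}
    (hXm : ∀ i, Measurable (X i)) (hYm : ∀ i, Measurable (Y i))
    (hX : ∀ i, HasSubgaussianMGF (X i) 4 P) (hY : ∀ i, HasSubgaussianMGF (Y i) 4 P)
    (hm : ∀ i, ∫ ω, X i ω * Y i ω ∂P = m) (hm4 : |m| ≤ 4)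
    (hind : iIndepFun (fun i ω => X i ω * Y i ω - m) P) {s ε : ℝ} (hs0 : 0 ≤ s) (hs : s ≤ 1 / 32) :
    P {ω | ε ≤ ∑ i, (X i ω * Y i ω - m)} ≤
      ENNReal.ofReal (Real.exp (-s * ε + 6144 * s ^ 2 * l)) := by
  have hsabs : |s| ≤ 1 / 32 := by rwa [abs_of_nonneg hs0]
  have hmeas : ∀ i, Measurable (fun ω => X i ω * Y i ω - m) := fun i => by
    have := hXm i
    have := hYm i
    fun_prop
  have hint : Integrable (fun ω => Real.exp (s * (∑ i, fun ω => X i ω * Y i ω - m) ω)) P :=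
    hind.integrable_exp_mul_sum hmeas fun i _ =>
      (integrable_exp_mul_product (hXm i) (hYm i) (hX i) (hY i) (hm i) hm4 hsabs).1
  have h := measure_ge_le_exp_mul_mgf ε hs0 hint
  rw [hind.mgf_sum hmeas] at h
  have hprod : ∏ i, mgf (fun ω => X i ω * Y i ω - m) P s ≤ Real.exp (6144 * s ^ 2 * l) := by
    calc ∏ i, mgf (fun ω => X i ω * Y i ω - m) P s ≤ ∏ _i : Fin l, Real.exp (6144 * s ^ 2) :=
          Finset.prod_le_prod (fun i _ => mgf_nonneg) fun i _ =>
            (integrable_exp_mul_product (hXm i) (hYm i) (hX i) (hY i) (hm i) hm4 hsabs).2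
      _ = _ := by
        rw [Finset.prod_const, Finset.card_univ, Fintype.card_fin, ← Real.exp_nat_mul]
        congr 1; ring
  have hset : {ω | ε ≤ ∑ i, (X i ω * Y i ω - m)} =
      {ω | ε ≤ (∑ i, fun ω => X i ω * Y i ω - m) ω} := by
    ext ω; simp only [Set.mem_ofPred_eq, Finset.sum_apply]
  rw [hset, ← ofReal_measureReal (measure_ne_top _ _)]
  refine ENNReal.ofReal_le_ofReal (h.trans ?_)
  rw [Real.exp_add]
  gcongr

/-- Sums of an independent family over disjoint blocks are independent. -/
lemma iIndepFun_sum_blocks {ι κ E : Type*} [AddCommMonoid E] [MeasurableSpace E] [MeasurableAdd₂ E]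
    {f : ι → Ω → E} (hf : iIndepFun f P) (hfm : ∀ i, Measurable (f i)) (S : κ → Finset ι)
    (hS : Pairwise fun a b => Disjoint (S a) (S b)) :
    iIndepFun (fun a ω => ∑ i ∈ S a, f i ω) P := by
  classical
  rw [iIndepFun_iff_measure_inter_preimage_eq_mul]
  intro K
  induction K using Finset.induction_on with
  | empty => intro s _; simp
  | insert a K ha ih =>
    intro s hs
    have hdisj : Disjoint (S a) (K.biUnion S) := by
      rw [Finset.disjoint_biUnion_right]
      exact fun b hb => hS fun h => ha (h ▸ hb)
    have hI := hf.indepFun_finset (S a) (K.biUnion S) hdisj hfm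
    -- The new block is separated from the union of the others; extending a tuple by `0` outside the
    -- union lets every other block sum be read off it, and that default is never reached.
    set U : Set (S a → E) := {x | ∑ i : S a, x i ∈ s a} with hU
    set V : Set (K.biUnion S → E) :=
      {x | ∀ b ∈ K, ∑ i ∈ S b, (if h : i ∈ K.biUnion S then x ⟨i, h⟩ else 0) ∈ s b} with hV
    have hUm : MeasurableSet U := by
      have hg : Measurable fun x : S a → E => ∑ i : S a, x i := by fun_prop
      exact hg (hs a (Finset.mem_insert_self _ _))
    have hVm : MeasurableSet V := by
      have : V = ⋂ b ∈ K, (fun x : K.biUnion S → E =>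
          ∑ i ∈ S b, (if h : i ∈ K.biUnion S then x ⟨i, h⟩ else 0)) ⁻¹' s b := by
        ext x; simp [hV]
      rw [this]
      refine K.measurableSet_biInter fun b hb => ?_
      have hg : Measurable fun x : K.biUnion S → E =>
          ∑ i ∈ S b, (if h : i ∈ K.biUnion S then x ⟨i, h⟩ else 0) := by
        refine Finset.measurable_fun_sum _ fun i _ => ?_
        split_ifs <;> fun_prop
      exact hg (hs b (Finset.mem_insert_of_mem hb))
    have h := hI.measure_inter_preimage_eq_mul U V hUm hVm
    have e1 : (fun ω (i : S a) => f i ω) ⁻¹' U = (fun ω => ∑ i ∈ S a, f i ω) ⁻¹' s a := by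
      ext ω
      simp only [hU, Set.mem_preimage, Set.mem_ofPred_eq]
      rw [Finset.sum_coe_sort (S a) fun i => f i ω]
    have e2 : (fun ω (i : K.biUnion S) => f i ω) ⁻¹' V =
        ⋂ b ∈ K, (fun ω => ∑ i ∈ S b, f i ω) ⁻¹' s b := by
      ext ω
      simp only [hV, Set.mem_preimage, Set.mem_ofPred_eq, Set.mem_iInter]
      refine forall₂_congr fun b hb => ?_
      rw [Finset.sum_congr rfl fun i hi => dif_pos (Finset.mem_biUnion.2 ⟨b, hb, hi⟩)]
    rw [Finset.set_biInter_insert, Finset.prod_insert ha, ← ih fun b hb =>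
      hs b (Finset.mem_insert_of_mem hb), ← e1, ← e2, h]

end SubGaussian

/-! ### Nets -/

/-- A net of at most `5 ^ d` points of norm at most `2` on which every functional of norm `t`
exceeds a value at least `t`. -/
lemma exists_norming_net (d : ℕ) : ∃ N : Finset (EuclideanSpace ℝ (Fin d)),
    N.card ≤ 5 ^ d ∧ (∀ p ∈ N, ‖p‖ ≤ 2) ∧
      ∀ (w : EuclideanSpace ℝ (Fin d)) (t : ℝ), 0 ≤ t → (∀ p ∈ N, inner ℝ w p ≤ t) → ‖w‖ ≤ t := by
  classical
  -- The net is a `1`-separated set of largest cardinality in the ball of radius `2`. The point of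
  -- norm `2` in the direction of `w` is within `1` of some `p`, so `⟨w, p⟩ > 2‖w‖ - ‖w‖`.
  set good : Finset (EuclideanSpace ℝ (Fin d)) → Prop := fun s =>
    (∀ p ∈ s, ‖p‖ ≤ 2) ∧ ∀ p ∈ s, ∀ q ∈ s, p ≠ q → 1 ≤ ‖p - q‖ with hgood
  have hcard : ∀ s, good s → s.card ≤ 5 ^ d := fun s hs => by
    have := Besicovitch.card_le_of_separated s hs.1 hs.2
    rwa [finrank_euclideanSpace_fin] at this
  obtain ⟨N, hN, hNc⟩ := Nat.findGreatest_spec (P := fun m => ∃ s, good s ∧ s.card = m)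
    (Nat.zero_le (5 ^ d)) ⟨∅, by simp [hgood], rfl⟩
  refine ⟨N, hcard N hN, hN.1, fun w t ht hw => ?_⟩
  by_contra hlt
  push Not at hlt
  have hw0 : 0 < ‖w‖ := ht.trans_lt hlt
  set x := (2 / ‖w‖) • w with hx
  have hxn : ‖x‖ = 2 := by
    rw [hx, norm_smul, Real.norm_eq_abs, abs_of_pos (by positivity)]; field_simp
  have hwx : (inner ℝ w x : ℝ) = 2 * ‖w‖ := by
    rw [hx, inner_smul_right, real_inner_self_eq_norm_sq]; field_simp
  have hnear : ∃ p ∈ N, ‖x - p‖ < 1 := by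
    by_contra hcon
    push Not at hcon
    have hxN : x ∉ N := fun h => by
      have := hcon x h
      simp at this
      linarith
    have hins : good (insert x N) := by
      refine ⟨fun p hp => ?_, fun p hp q hq hpq => ?_⟩
      · rcases Finset.mem_insert.1 hp with rfl | hp
        · exact hxn.le
        · exact hN.1 p hp
      · rcases Finset.mem_insert.1 hp with hp' | hp' <;> rcases Finset.mem_insert.1 hq with hq' | hq'
        · exact absurd (hp'.trans hq'.symm) hpq
        · rw [hp']; exact hcon q hq'
        · rw [hq', norm_sub_rev]; exact hcon p hp'
        · exact hN.2 p hp' q hq' hpq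
    have := Nat.le_findGreatest (P := fun m => ∃ s, good s ∧ s.card = m)
      (hcard _ hins) ⟨insert x N, hins, rfl⟩
    rw [Finset.card_insert_of_notMem hxN, hNc] at this
    omega
  obtain ⟨p, hp, hxp⟩ := hnear
  have h1 := hw p hp
  have h2 : (inner ℝ w (x - p) : ℝ) ≤ ‖w‖ * ‖x - p‖ := real_inner_le_norm _ _
  rw [inner_sub_right, hwx] at h2
  nlinarith

/-! ### Concentration of the noise -/

section Noise

open scoped NNReal

variable {Ω : Type*} [MeasurableSpace Ω] {P : Measure Ω} {n d : ℕ}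
  {ξ : Fin n → Ω → EuclideanSpace ℝ (Fin d)}

lemma hasSubgaussianMGF_mono {X : Ω → ℝ} {c c' : ℝ≥0} (hX : HasSubgaussianMGF X c P)
    (h : c ≤ c') : HasSubgaussianMGF X c' P where
  integrable_exp_mul := hX.integrable_exp_mul
  mgf_le t := (hX.mgf_le t).trans (Real.exp_le_exp.2 (by
    have : (c : ℝ) ≤ c' := by exact_mod_cast h
    gcongr))

lemma IsNoise.hasSubgaussianMGF_inner (hξ : IsNoise P ξ) (i : Fin n)
    (v : EuclideanSpace ℝ (Fin d)) :
    HasSubgaussianMGF (fun ω => inner ℝ v (ξ i ω)) (‖v‖₊ ^ 2) P where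
  integrable_exp_mul t := by
    have := (hξ.subGaussian i (t • v)).1
    simpa only [real_inner_smul_left] using this
  mgf_le t := by
    have := (hξ.subGaussian i (t • v)).2
    simp only [real_inner_smul_left] at this
    refine this.trans (Real.exp_le_exp.2 (le_of_eq ?_))
    rw [norm_smul, Real.norm_eq_abs, mul_pow, sq_abs]
    push_cast
    ring

lemma IsNoise.hasSubgaussianMGF_sum (hξ : IsNoise P ξ) (S : Finset (Fin n))
    (v : EuclideanSpace ℝ (Fin d)) :
    HasSubgaussianMGF (fun ω => inner ℝ v (∑ j ∈ S, ξ j ω)) (S.card * ‖v‖₊ ^ 2) P := by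
  have hind : iIndepFun (fun j ω => (inner ℝ v (ξ j ω) : ℝ)) P :=
    hξ.indep.comp (fun _ x => inner ℝ v x) fun _ => by fun_prop
  have := HasSubgaussianMGF.sum_of_iIndepFun hind (s := S) (c := fun _ => ‖v‖₊ ^ 2)
    fun j _ => hξ.hasSubgaussianMGF_inner j v
  simpa only [inner_sum, Finset.sum_const, nsmul_eq_mul] using this

lemma IsNoise.hasSubgaussianMGF_bucketMean (hξ : IsNoise P ξ) {l : ℕ} (hl : 1 ≤ l) (hln : l ≤ n)
    (i : Fin l) (v : EuclideanSpace ℝ (Fin d)) {c : ℝ≥0} (hc : ‖v‖ ^ 2 / bucketLen n l ≤ c) :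
    HasSubgaussianMGF (fun ω => inner ℝ v (bucketMean (fun j => ξ j ω) l i)) c P := by
  have hk : (0 : ℝ) < bucketLen n l := by exact_mod_cast bucketLen_pos hl hln
  have h := hξ.hasSubgaussianMGF_sum (bucket n l i) ((1 / (bucketLen n l : ℝ)) • v)
  rw [card_bucket] at h
  have h' : HasSubgaussianMGF (fun ω => inner ℝ v (bucketMean (fun j => ξ j ω) l i))
      (bucketLen n l * ‖(1 / (bucketLen n l : ℝ)) • v‖₊ ^ 2) P := by
    simpa only [bucketMean, real_inner_smul_left, real_inner_smul_right] using h
  refine hasSubgaussianMGF_mono h' ?_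
  rw [← NNReal.coe_le_coe]
  push_cast
  rw [norm_smul, Real.norm_eq_abs, abs_of_pos (by positivity)]
  refine le_trans (le_of_eq ?_) hc
  field_simp

lemma IsNoise.measurable_bucketMean (hξ : IsNoise P ξ) (l : ℕ) (i : Fin l) :
    Measurable fun ω => bucketMean (fun j => ξ j ω) l i := by
  have := hξ.measurable
  unfold bucketMean
  fun_prop

variable [IsProbabilityMeasure P]

lemma IsNoise.integral_sum_mul_sum (hξ : IsNoise P ξ) (S : Finset (Fin n))
    (u v : EuclideanSpace ℝ (Fin d)) :
    ∫ ω, inner ℝ u (∑ j ∈ S, ξ j ω) * inner ℝ v (∑ j ∈ S, ξ j ω) ∂P = S.card * inner ℝ u v := by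
  have hint : ∀ i j, Integrable (fun ω => inner ℝ u (ξ i ω) * inner ℝ v (ξ j ω)) P := fun i j =>
    integrable_mul_of_hasSubgaussianMGF (hξ.hasSubgaussianMGF_inner i u)
      (hξ.hasSubgaussianMGF_inner j v)
  have hval : ∀ i j, ∫ ω, inner ℝ u (ξ i ω) * inner ℝ v (ξ j ω) ∂P =
      if i = j then inner ℝ u v else 0 := by
    intro i j
    split_ifs with h
    · subst h; exact hξ.isotropic i u v
    · have hI : IndepFun (fun ω => (inner ℝ u (ξ i ω) : ℝ)) (fun ω => (inner ℝ v (ξ j ω) : ℝ)) P :=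
        (hξ.indep.indepFun h).comp (φ := fun x => (inner ℝ u x : ℝ))
          (ψ := fun x => (inner ℝ v x : ℝ)) (by fun_prop) (by fun_prop)
      have h1 := (hξ.hasSubgaussianMGF_inner i u).aestronglyMeasurable
      have h2 := (hξ.hasSubgaussianMGF_inner j v).aestronglyMeasurable
      rw [hI.integral_fun_mul_eq_mul_integral h1 h2,
        integral_eq_zero_of_hasSubgaussianMGF (hξ.hasSubgaussianMGF_inner i u), zero_mul]
  simp_rw [inner_sum, Finset.sum_mul_sum]
  rw [integral_finsetSum _ fun i _ => integrable_finsetSum _ fun j _ => hint i j]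
  simp_rw [integral_finsetSum S fun j _ => hint _ j, hval]
  simp

lemma IsNoise.integral_bucketMean_mul (hξ : IsNoise P ξ) {l : ℕ} (hl : 1 ≤ l) (hln : l ≤ n)
    (i : Fin l) (u v : EuclideanSpace ℝ (Fin d)) :
    ∫ ω, inner ℝ u (bucketMean (fun j => ξ j ω) l i) *
      inner ℝ v (bucketMean (fun j => ξ j ω) l i) ∂P = inner ℝ u v / bucketLen n l := by
  have hk : (0 : ℝ) < bucketLen n l := by exact_mod_cast bucketLen_pos hl hln
  have h := hξ.integral_sum_mul_sum (bucket n l i) u v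
  simp only [bucketMean, real_inner_smul_right]
  simp_rw [mul_mul_mul_comm _ (inner ℝ u _ : ℝ)]
  rw [integral_const_mul, h, card_bucket]
  field_simp

lemma IsNoise.iIndepFun_bucketMean (hξ : IsNoise P ξ) (l : ℕ) :
    iIndepFun (fun (i : Fin l) ω => bucketMean (fun j => ξ j ω) l i) P := by
  have h := iIndepFun_sum_blocks hξ.indep hξ.measurable (fun i : Fin l => bucket n l i)
    fun i j hij => bucket_disjoint hij
  exact h.comp (fun _ x => (1 / (bucketLen n l : ℝ)) • x) fun _ => by fun_prop

/-- The net is used twice: bounds on pairs give `‖B p‖ ≤ t` for `p` in the net, and symmetry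
transfers this to an arbitrary `x`. -/
lemma norm_le_of_symmetric_of_net {B : EuclideanSpace ℝ (Fin d) → EuclideanSpace ℝ (Fin d)}
    {N : Finset (EuclideanSpace ℝ (Fin d))} {t : ℝ} (ht : 0 ≤ t)
    (hN : ∀ (w : EuclideanSpace ℝ (Fin d)) (t : ℝ), 0 ≤ t →
      (∀ p ∈ N, inner ℝ w p ≤ t) → ‖w‖ ≤ t)
    (hsymm : ∀ x z, (inner ℝ (B x) z : ℝ) = inner ℝ x (B z))
    (hB : ∀ p ∈ N, ∀ q ∈ N, inner ℝ (B p) q ≤ t) (x : EuclideanSpace ℝ (Fin d)) :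
    ‖B x‖ ≤ t * ‖x‖ := by
  refine hN _ _ (by positivity) fun p hp => ?_
  rw [hsymm, mul_comm]
  refine (real_inner_le_norm _ _).trans ?_
  gcongr
  exact hN _ _ ht (hB p hp)

/-- Bernstein for each pair of net points, then a union bound over at most `25 ^ d ≤ exp (4d)`
pairs. The condition `d ≤ l` keeps the deviation in the Gaussian regime. -/
lemma IsNoise.measure_noiseCov_gt_le (hξ : IsNoise P ξ) (hd : 1 ≤ d) {l : ℕ} (hdl : d ≤ l)
    (hln : l ≤ n) :
    P {ω | ¬ ∀ x z : EuclideanSpace ℝ (Fin d),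
      |1 / (l : ℝ) * ∑ i, inner ℝ x (bucketMean (fun j => ξ j ω) l i) *
          inner ℝ z (bucketMean (fun j => ξ j ω) l i) - 1 / (bucketLen n l : ℝ) * inner ℝ x z| ≤
        704 * noiseLevel n d l * ‖x‖ * ‖z‖} ≤ ENNReal.ofReal (Real.exp (-d)) := by
  have hl : 1 ≤ l := hd.trans hdl
  have hk : (0 : ℝ) < bucketLen n l := by exact_mod_cast bucketLen_pos hl hln
  have hl' : (0 : ℝ) < l := by exact_mod_cast hl
  have hd' : (0 : ℝ) < d := by exact_mod_cast hd
  have hn' : (0 : ℝ) < n := by exact_mod_cast hl.trans hln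
  set k : ℝ := (bucketLen n l : ℝ) with hkdef
  obtain ⟨N, hNc, hN2, hN⟩ := exists_norming_net d
  set ε : ℝ := 352 * √((d : ℝ) * l) with hε
  -- The factor `√k` normalizes the bucket means: net points have norm at most `2`, so the variance
  -- proxy is `4`.
  set W : EuclideanSpace ℝ (Fin d) → EuclideanSpace ℝ (Fin d) → Ω → ℝ := fun p q ω =>
    ∑ i, (inner ℝ (√k • p) (bucketMean (fun j => ξ j ω) l i) *
      inner ℝ (√k • q) (bucketMean (fun j => ξ j ω) l i) - inner ℝ p q) with hW
  have htail : ∀ p ∈ N, ∀ q ∈ N, P {ω | ε ≤ W p q ω} ≤ ENNReal.ofReal (Real.exp (-5 * d)) := by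
    intro p hp q hq
    have hsub : ∀ p ∈ N, ∀ i : Fin l, HasSubgaussianMGF
        (fun ω => inner ℝ (√k • p) (bucketMean (fun j => ξ j ω) l i)) 4 P := fun p hp i => by
      refine hξ.hasSubgaussianMGF_bucketMean hl hln i _ ?_
      rw [norm_smul, mul_pow, Real.norm_eq_abs, sq_abs, Real.sq_sqrt hk.le, ← hkdef,
        mul_div_assoc, mul_div_left_comm, div_self hk.ne', mul_one]
      have := pow_le_pow_left₀ (norm_nonneg _) (hN2 p hp) 2
      push_cast
      linarith
    have hmeas : ∀ p, ∀ i : Fin l, Measurable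
        (fun ω => (inner ℝ (√k • p) (bucketMean (fun j => ξ j ω) l i) : ℝ)) := fun p i => by
      have := hξ.measurable_bucketMean l i
      fun_prop
    have hm4 : |(inner ℝ p q : ℝ)| ≤ 4 := by
      refine (abs_real_inner_le_norm p q).trans ?_
      nlinarith [hN2 p hp, hN2 q hq, norm_nonneg p, norm_nonneg q]
    have hind : iIndepFun (fun (i : Fin l) ω =>
        inner ℝ (√k • p) (bucketMean (fun j => ξ j ω) l i) *
          inner ℝ (√k • q) (bucketMean (fun j => ξ j ω) l i) - (inner ℝ p q : ℝ)) P :=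
      (hξ.iIndepFun_bucketMean l).comp
        (fun _ x => inner ℝ (√k • p) x * inner ℝ (√k • q) x - (inner ℝ p q : ℝ))
        fun _ => by fun_prop
    have hmean : ∀ i : Fin l, ∫ ω, inner ℝ (√k • p) (bucketMean (fun j => ξ j ω) l i) *
          inner ℝ (√k • q) (bucketMean (fun j => ξ j ω) l i) ∂P = inner ℝ p q := fun i => by
      rw [hξ.integral_bucketMean_mul hl hln, real_inner_smul_left, real_inner_smul_right,
        ← mul_assoc, Real.mul_self_sqrt hk.le, ← hkdef]
      field_simp
    set r : ℝ := √((d : ℝ) / l) with hr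
    have hr2 : r ^ 2 = d / l := Real.sq_sqrt (by positivity)
    have hr1 : r ≤ 1 := by
      refine Real.sqrt_le_iff.2 ⟨zero_le_one, ?_⟩
      rw [one_pow, div_le_one hl']
      exact_mod_cast hdl
    have hrl : √((d : ℝ) * l) = r * l := by
      rw [hr, ← Real.sqrt_sq hl'.le, ← Real.sqrt_mul (by positivity), Real.sqrt_sq hl'.le]
      congr 1; field_simp
    -- With `s = r/32` and `r² l = d` the exponent is `-(352/32) d + (6144/32²) d = -11d + 6d =
    -- -5d`.
    have h := measure_sum_product_ge_le (hmeas p) (hmeas q) (hsub p hp) (hsub q hq) hmean hm4 hind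
      (s := r / 32) (ε := ε) (by positivity) (by linarith)
    refine h.trans (ENNReal.ofReal_le_ofReal (Real.exp_le_exp.2 (le_of_eq ?_)))
    rw [hε, hrl]
    have : r ^ 2 * l = d := by rw [hr2]; field_simp
    linear_combination (-5 : ℝ) * this
  have hsubset : {ω | ¬ ∀ x z : EuclideanSpace ℝ (Fin d),
      |1 / (l : ℝ) * ∑ i, inner ℝ x (bucketMean (fun j => ξ j ω) l i) *
          inner ℝ z (bucketMean (fun j => ξ j ω) l i) - 1 / k * inner ℝ x z| ≤
        704 * noiseLevel n d l * ‖x‖ * ‖z‖} ⊆ ⋃ p ∈ N, ⋃ q ∈ N, {ω | ε ≤ W p q ω} := by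
    intro ω hω
    by_contra hcon
    simp only [Set.mem_iUnion, Set.mem_ofPred_eq, not_exists, not_le] at hcon
    refine hω fun x z => ?_
    set m : Fin l → EuclideanSpace ℝ (Fin d) := fun i => bucketMean (fun j => ξ j ω) l i with hm
    set B : EuclideanSpace ℝ (Fin d) → EuclideanSpace ℝ (Fin d) := fun x =>
      (1 / (l : ℝ)) • ∑ i, (inner ℝ x (m i) : ℝ) • m i - (1 / k) • x with hB
    have hBin : ∀ x z, (inner ℝ (B x) z : ℝ) =
        1 / (l : ℝ) * ∑ i, inner ℝ x (m i) * inner ℝ z (m i) - 1 / k * inner ℝ x z := by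
      intro x z
      have hc : ∀ i, (inner ℝ (m i) z : ℝ) = inner ℝ z (m i) := fun i => real_inner_comm _ _
      simp only [hB, inner_sub_left, real_inner_smul_left, sum_inner, hc]
    have hsymm : ∀ x z, (inner ℝ (B x) z : ℝ) = inner ℝ x (B z) := by
      intro x z
      rw [real_inner_comm (B z) x, hBin, hBin, real_inner_comm x z]
      simp_rw [mul_comm (inner ℝ x _ : ℝ)]
    have hBN : ∀ p ∈ N, ∀ q ∈ N, inner ℝ (B p) q ≤ 704 * noiseLevel n d l := by
      intro p hp q hq
      have h := (hcon p hp q hq).le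
      have hWe : W p q ω = k * l * inner ℝ (B p) q := by
        have : ∀ i, inner ℝ (√k • p) (m i) * inner ℝ (√k • q) (m i) - (inner ℝ p q : ℝ) =
            k * (inner ℝ p (m i) * inner ℝ q (m i)) - inner ℝ p q := fun i => by
          rw [real_inner_smul_left, real_inner_smul_left, mul_mul_mul_comm,
            Real.mul_self_sqrt hk.le]
        rw [hBin]
        simp only [hW]
        rw [Finset.sum_congr rfl fun i _ => this i, Finset.sum_sub_distrib, ← Finset.mul_sum]
        simp only [Finset.sum_const, Finset.card_univ, Fintype.card_fin, nsmul_eq_mul]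
        field_simp
      rw [hWe] at h
      have hkl := le_two_mul_bucketLen_mul hl hln
      rw [← hkdef] at hkl
      have h1 : inner ℝ (B p) q ≤ ε / (k * l) := by
        rw [le_div_iff₀ (by positivity)]; linarith
      refine h1.trans ?_
      rw [hε, noiseLevel, div_le_iff₀ (by positivity)]
      have : √((d : ℝ) * l) ≤ √((d : ℝ) * l) / n * (2 * (k * l)) := by
        rw [div_mul_eq_mul_div, le_div_iff₀ hn']
        gcongr
      linarith
    have hfin := norm_le_of_symmetric_of_net
      (by have := noiseLevel_nonneg n d l; positivity) hN hsymm hBN x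
    rw [← hBin]
    refine (abs_real_inner_le_norm _ _).trans ?_
    gcongr
  refine (measure_mono hsubset).trans ?_
  calc P (⋃ p ∈ N, ⋃ q ∈ N, {ω | ε ≤ W p q ω})
      ≤ ∑ p ∈ N, ∑ q ∈ N, P {ω | ε ≤ W p q ω} :=
        (measure_biUnion_finset_le _ _).trans
          (Finset.sum_le_sum fun p _ => measure_biUnion_finset_le _ _)
    _ ≤ ∑ p ∈ N, ∑ q ∈ N, ENNReal.ofReal (Real.exp (-5 * d)) :=
        Finset.sum_le_sum fun p hp => Finset.sum_le_sum fun q hq => htail p hp q hq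
    _ = ENNReal.ofReal ((N.card : ℝ) ^ 2 * Real.exp (-5 * d)) := by
        simp only [Finset.sum_const, nsmul_eq_mul]
        rw [ENNReal.ofReal_mul (by positivity), ENNReal.ofReal_pow (by positivity),
          ENNReal.ofReal_natCast, sq, mul_assoc]
    _ ≤ ENNReal.ofReal (Real.exp (-d)) := by
        refine ENNReal.ofReal_le_ofReal ?_
        have h1 : (N.card : ℝ) ≤ 5 ^ d := by exact_mod_cast hNc
        have h2 : (5 : ℝ) ≤ Real.exp 2 := by
          have := Real.quadratic_le_exp_of_nonneg (x := 2) (by norm_num)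
          linarith
        calc (N.card : ℝ) ^ 2 * Real.exp (-5 * d) ≤ (Real.exp 2 ^ d) ^ 2 * Real.exp (-5 * d) := by
              gcongr
              exact h1.trans (pow_le_pow_left₀ (by norm_num) h2 d)
          _ = Real.exp (-d) := by
              rw [← Real.exp_nat_mul, ← Real.exp_nat_mul, ← Real.exp_add]
              congr 1; push_cast; ring

/-- The mean of the products of the label and noise averages of the buckets. -/
noncomputable def crossMean (e : Fin n → ℝ) (x : Fin n → EuclideanSpace ℝ (Fin d)) (l : ℕ) :
    EuclideanSpace ℝ (Fin d) :=
  (1 / (l : ℝ)) • ∑ i : Fin l, bucketAvg e l i • bucketMean x l i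

lemma measurable_crossMean (e : Fin n → ℝ) (l : ℕ) :
    Measurable fun x : Fin n → EuclideanSpace ℝ (Fin d) => crossMean e x l := by
  unfold crossMean bucketMean
  fun_prop

/-- For fixed labels the cross term is linear in the noise, so each net direction has a sub-Gaussian
tail; the exponent, at most `-25d/4`, is weakened to `-3d` and beats the `5 ^ d ≤ exp (2d)` net
points. -/
lemma IsNoise.measure_crossMean_gt_le (hξ : IsNoise P ξ) (hd : 1 ≤ d) {l : ℕ} (hdl : d ≤ l)
    (hln : l ≤ n) {e : Fin n → ℝ} (he : ∀ j, |e j| ≤ 1) :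
    P {ω | 10 * √((d : ℝ) / n) < ‖crossMean e (fun j => ξ j ω) l‖} ≤
      ENNReal.ofReal (Real.exp (-d)) := by
  have hl : 1 ≤ l := hd.trans hdl
  have hk : (0 : ℝ) < bucketLen n l := by exact_mod_cast bucketLen_pos hl hln
  have hl' : (0 : ℝ) < l := by exact_mod_cast hl
  have hn' : (0 : ℝ) < n := by exact_mod_cast hl.trans hln
  have hkl := le_two_mul_bucketLen_mul hl hln
  set k : ℝ := (bucketLen n l : ℝ) with hkdef
  obtain ⟨N, hNc, hN2, hN⟩ := exists_norming_net d
  set ε : ℝ := 10 * √((d : ℝ) / n) with hε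
  have hε0 : 0 ≤ ε := by positivity
  have htail : ∀ p ∈ N, P {ω | ε ≤ inner ℝ (crossMean e (fun j => ξ j ω) l) p} ≤
      ENNReal.ofReal (Real.exp (-3 * d)) := by
    intro p hp
    set c : ℝ≥0 := Real.toNNReal (4 / (k * l ^ 2)) with hc
    have hcc : (c : ℝ) = 4 / (k * l ^ 2) := Real.coe_toNNReal _ (by positivity)
    have hsub : ∀ i : Fin l, HasSubgaussianMGF (fun ω => inner ℝ ((bucketAvg e l i / l) • p)
        (bucketMean (fun j => ξ j ω) l i)) c P := fun i => by
      refine hξ.hasSubgaussianMGF_bucketMean hl hln i _ ?_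
      rw [hcc, norm_smul, mul_pow, Real.norm_eq_abs, sq_abs, div_pow, ← hkdef]
      have h1 := pow_le_pow_left₀ (norm_nonneg _) (hN2 p hp) 2
      have h2 : bucketAvg e l i ^ 2 ≤ 1 := (sq_le_one_iff_abs_le_one _).2 (abs_bucketAvg_le he i)
      calc bucketAvg e l i ^ 2 / (l : ℝ) ^ 2 * ‖p‖ ^ 2 / k ≤ 1 / (l : ℝ) ^ 2 * 2 ^ 2 / k := by gcongr
        _ = _ := by field_simp; norm_num
    have hind : iIndepFun (fun (i : Fin l) ω => (inner ℝ ((bucketAvg e l i / l) • p)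
        (bucketMean (fun j => ξ j ω) l i) : ℝ)) P :=
      (hξ.iIndepFun_bucketMean l).comp (fun i x => inner ℝ ((bucketAvg e l i / l) • p) x)
        fun _ => by fun_prop
    have h := HasSubgaussianMGF.measure_sum_ge_le_of_iIndepFun hind (s := Finset.univ)
      (c := fun _ => c) (fun i _ => hsub i) hε0
    have hset : {ω | ε ≤ inner ℝ (crossMean e (fun j => ξ j ω) l) p} =
        {ω | ε ≤ ∑ i : Fin l, (inner ℝ ((bucketAvg e l i / l) • p)
          (bucketMean (fun j => ξ j ω) l i) : ℝ)} := by
      ext ω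
      have : inner ℝ (crossMean e (fun j => ξ j ω) l) p = ∑ i : Fin l,
          (inner ℝ ((bucketAvg e l i / l) • p) (bucketMean (fun j => ξ j ω) l i) : ℝ) := by
        simp only [crossMean, real_inner_smul_left, sum_inner, Finset.mul_sum]
        refine Finset.sum_congr rfl fun i _ => ?_
        rw [real_inner_comm p]
        ring
      simp only [Set.mem_ofPred_eq, this]
    rw [hset, ← ofReal_measureReal (measure_ne_top _ _)]
    refine ENNReal.ofReal_le_ofReal (h.trans (Real.exp_le_exp.2 ?_))
    rw [Finset.sum_const, Finset.card_univ, Fintype.card_fin]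
    push_cast
    rw [nsmul_eq_mul, hcc, hε, mul_pow, Real.sq_sqrt (by positivity)]
    have e1 : -(10 ^ 2 * ((d : ℝ) / n)) / (2 * (l * (4 / (k * l ^ 2)))) =
        -(25 / 2) * d * ((k * l) / n) := by field_simp; norm_num
    have e2 : 1 / 2 ≤ (k * l) / n := by
      rw [div_le_div_iff₀ (by norm_num) hn']; linarith
    rw [e1]
    have := mul_le_mul_of_nonneg_left e2 (by positivity : (0 : ℝ) ≤ 25 / 2 * d)
    have hd0 : (0 : ℝ) ≤ d := by positivity
    linarith
  have hsubset : {ω | ε < ‖crossMean e (fun j => ξ j ω) l‖} ⊆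
      ⋃ p ∈ N, {ω | ε ≤ inner ℝ (crossMean e (fun j => ξ j ω) l) p} := by
    intro ω hω
    by_contra hcon
    simp only [Set.mem_iUnion, Set.mem_ofPred_eq, not_exists, not_le] at hcon
    exact absurd (hN _ _ hε0 fun p hp => (hcon p hp).le) (not_le.2 hω)
  refine (measure_mono hsubset).trans ?_
  calc P (⋃ p ∈ N, {ω | ε ≤ inner ℝ (crossMean e (fun j => ξ j ω) l) p})
      ≤ ∑ p ∈ N, P {ω | ε ≤ inner ℝ (crossMean e (fun j => ξ j ω) l) p} :=
        measure_biUnion_finset_le _ _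
    _ ≤ ∑ p ∈ N, ENNReal.ofReal (Real.exp (-3 * d)) := Finset.sum_le_sum htail
    _ = ENNReal.ofReal ((N.card : ℝ) * Real.exp (-3 * d)) := by
        rw [Finset.sum_const, nsmul_eq_mul, ENNReal.ofReal_mul (by positivity),
          ENNReal.ofReal_natCast]
    _ ≤ ENNReal.ofReal (Real.exp (-d)) := by
        refine ENNReal.ofReal_le_ofReal ?_
        have h1 : (N.card : ℝ) ≤ 5 ^ d := by exact_mod_cast hNc
        have h2 : (5 : ℝ) ≤ Real.exp 2 := by
          have := Real.quadratic_le_exp_of_nonneg (x := 2) (by norm_num)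
          linarith
        calc (N.card : ℝ) * Real.exp (-3 * d) ≤ (Real.exp 2 ^ d) * Real.exp (-3 * d) := by
              gcongr
              exact h1.trans (pow_le_pow_left₀ (by norm_num) h2 d)
          _ = Real.exp (-d) := by
              rw [← Real.exp_nat_mul, ← Real.exp_add]
              congr 1; ring

/-- Conditioning on the labels: by independence the fixed-label bound applies on each path event,
and these disjoint events have total mass at most `1`. -/
lemma IsModel.measure_crossMean_gt_le {δ : ℝ} {η : Fin n → Ω → ℝ} (hM : IsModel P δ η ξ)
    (hd : 1 ≤ d) {l : ℕ} (hdl : d ≤ l) (hln : l ≤ n) :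
    P {ω | ∃ b, (∀ i, η i ω = signPath b i) ∧
      10 * √((d : ℝ) / n) < ‖crossMean (signPath b) (fun j => ξ j ω) l‖} ≤
      ENNReal.ofReal (Real.exp (-d)) := by
  have hmeas : ∀ b, MeasurableSet {ω | ∀ i, η i ω = signPath b i} := fun b => by
    rw [Set.ofPred_forall]
    exact MeasurableSet.iInter fun i => hM.chain.measurable i (measurableSet_singleton _)
  have hsum : ∑ b : Fin n → Bool, P {ω | ∀ i, η i ω = signPath b i} ≤ 1 := by
    rw [← tsum_fintype (L := .unconditional _), ← measure_iUnion _ hmeas]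
    · exact prob_le_one
    · intro b b' hbb
      refine Set.disjoint_left.2 fun ω h h' => hbb (signPath_injective ?_)
      funext i
      exact (h i).symm.trans (h' i)
  have hterm : ∀ b : Fin n → Bool, P ({ω | ∀ i, η i ω = signPath b i} ∩
      {ω | 10 * √((d : ℝ) / n) < ‖crossMean (signPath b) (fun j => ξ j ω) l‖}) ≤
      P {ω | ∀ i, η i ω = signPath b i} * ENNReal.ofReal (Real.exp (-d)) := by
    intro b
    have hB : MeasurableSet {x : Fin n → EuclideanSpace ℝ (Fin d) |
        10 * √((d : ℝ) / n) < ‖crossMean (signPath b) x l‖} :=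
      measurableSet_lt measurable_const (measurable_crossMean _ l).norm
    have h := hM.indep.measure_inter_preimage_eq_mul _ {signPath b} hB (measurableSet_singleton _)
    have e : (fun ω i => η i ω) ⁻¹' {signPath b} = {ω | ∀ i, η i ω = signPath b i} := by
      ext ω; simp [funext_iff]
    rw [e, Set.preimage_ofPred_eq] at h
    rw [Set.inter_comm, h, mul_comm]
    gcongr
    exact hM.noise.measure_crossMean_gt_le hd hdl hln (abs_signPath_le b)
  have hset : {ω | ∃ b, (∀ i, η i ω = signPath b i) ∧
      10 * √((d : ℝ) / n) < ‖crossMean (signPath b) (fun j => ξ j ω) l‖} ⊆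
      ⋃ b : Fin n → Bool, ({ω | ∀ i, η i ω = signPath b i} ∩
        {ω | 10 * √((d : ℝ) / n) < ‖crossMean (signPath b) (fun j => ξ j ω) l‖}) := by
    rintro ω ⟨b, h1, h2⟩
    exact Set.mem_iUnion.2 ⟨b, h1, h2⟩
  refine (measure_mono hset).trans ((measure_iUnion_fintype_le _ _).trans ?_)
  calc _ ≤ ∑ b : Fin n → Bool, P {ω | ∀ i, η i ω = signPath b i} *
        ENNReal.ofReal (Real.exp (-d)) := Finset.sum_le_sum fun b _ => hterm b
    _ ≤ 1 * ENNReal.ofReal (Real.exp (-d)) := by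
        rw [← Finset.sum_mul]; gcongr
    _ = _ := one_mul _

end Noise

/-! ### The estimators at a fixed number of buckets -/

section Fixed

variable {n d : ℕ}

/-- The quadratic mean of the bucket averages of the labels. -/
noncomputable def labelScale (e : Fin n → ℝ) (l : ℕ) : ℝ :=
  √(1 / (l : ℝ) * ∑ i : Fin l, bucketAvg e l i ^ 2)

lemma labelScale_nonneg (e : Fin n → ℝ) (l : ℕ) : 0 ≤ labelScale e l := Real.sqrt_nonneg _

lemma labelScale_sq (e : Fin n → ℝ) (l : ℕ) :
    labelScale e l ^ 2 = 1 / (l : ℝ) * ∑ i : Fin l, bucketAvg e l i ^ 2 :=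
  Real.sq_sqrt (by positivity)

lemma labelScale_le_one {e : Fin n → ℝ} (he : ∀ j, |e j| ≤ 1) (l : ℕ) : labelScale e l ≤ 1 := by
  refine Real.sqrt_le_iff.2 ⟨zero_le_one, ?_⟩
  have h : ∑ i : Fin l, bucketAvg e l i ^ 2 ≤ l := by
    calc ∑ i : Fin l, bucketAvg e l i ^ 2 ≤ ∑ _i : Fin l, (1 : ℝ) :=
          Finset.sum_le_sum fun i _ => (sq_le_one_iff_abs_le_one _).2 (abs_bucketAvg_le he i)
      _ = l := by simp
  rw [one_pow, one_div_mul_eq_div]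
  exact div_le_one_of_le₀ h (by positivity)

lemma one_sub_labelScale_sq_le {l : ℕ} (hl : 1 ≤ l) (hln : l ≤ n) (b : Fin n → Bool) :
    1 - labelScale (signPath b) l ^ 2 ≤ ((flipSet b).card : ℝ) / l := by
  have hl' : (0 : ℝ) < l := by exact_mod_cast hl
  have h := sum_one_sub_bucketAvg_sq_le hl hln b
  rw [Finset.sum_sub_distrib] at h
  simp only [Finset.sum_const, Finset.card_univ, Fintype.card_fin, nsmul_eq_mul, mul_one] at h
  rw [labelScale_sq, le_div_iff₀ hl']
  have : (1 - 1 / (l : ℝ) * ∑ i : Fin l, bucketAvg (signPath b) l i ^ 2) * l =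
      l - ∑ i : Fin l, bucketAvg (signPath b) l i ^ 2 := by field_simp
  rwa [this]

lemma labelScale_eq_one {l : ℕ} (hl : 1 ≤ l) (hk : bucketLen n l = 1) (b : Fin n → Bool) :
    labelScale (signPath b) l = 1 := by
  have hl' : (0 : ℝ) < l := by exact_mod_cast hl
  have h : ∀ i : Fin l, bucketAvg (signPath b) l i ^ 2 = 1 := by
    intro i
    have hc := card_bucket (n := n) i
    rw [hk] at hc
    obtain ⟨j, hj⟩ := Finset.card_eq_one.1 hc
    rw [bucketAvg, hj, hk, Finset.sum_singleton]
    rcases signPath_eq_or b j with h | h <;> simp [h]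
  unfold labelScale
  rw [Finset.sum_congr rfl fun i _ => h i]
  simp [hl'.ne']

lemma bucketMean_obs {l : ℕ} (e : Fin n → ℝ) (θ : EuclideanSpace ℝ (Fin d))
    (x : Fin n → EuclideanSpace ℝ (Fin d)) (i : Fin l) :
    bucketMean (fun j => e j • θ + x j) l i = bucketAvg e l i • θ + bucketMean x l i := by
  rw [bucketMean, bucketMean, bucketAvg, Finset.sum_add_distrib, smul_add, ← Finset.sum_smul,
    smul_smul]

/-- Expanding the bucket means gives the signal `a² θθᵀ`, two cross terms of size `‖θ‖ β` each, and
the noise covariance. -/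
lemma abs_inner_sampleCov_sub_le {l : ℕ} {e : Fin n → ℝ} {θ : EuclideanSpace ℝ (Fin d)}
    {x : Fin n → EuclideanSpace ℝ (Fin d)} {α β : ℝ}
    (hcov : ∀ u z : EuclideanSpace ℝ (Fin d),
      |1 / (l : ℝ) * ∑ i, inner ℝ u (bucketMean x l i) * inner ℝ z (bucketMean x l i) -
        1 / (bucketLen n l : ℝ) * inner ℝ u z| ≤ α * ‖u‖ * ‖z‖)
    (hcross : ‖crossMean e x l‖ ≤ β) (u z : EuclideanSpace ℝ (Fin d)) :
    |inner ℝ u (Matrix.toEuclideanLin (sampleCov (fun j => e j • θ + x j) l) z) -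
        1 / (bucketLen n l : ℝ) * inner ℝ u z -
        inner ℝ u (labelScale e l • θ) * inner ℝ z (labelScale e l • θ)| ≤
      (2 * ‖θ‖ * β + α) * ‖u‖ * ‖z‖ := by
  have hw : ∀ u : EuclideanSpace ℝ (Fin d), inner ℝ u (crossMean e x l) =
      1 / (l : ℝ) * ∑ i, bucketAvg e l i * inner ℝ u (bucketMean x l i) := fun u => by
    simp only [crossMean, real_inner_smul_right, inner_sum]
  have hexp : inner ℝ u (Matrix.toEuclideanLin (sampleCov (fun j => e j • θ + x j) l) z) =
      labelScale e l ^ 2 * (inner ℝ u θ * inner ℝ z θ) +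
        (inner ℝ u θ * inner ℝ z (crossMean e x l) + inner ℝ z θ * inner ℝ u (crossMean e x l)) +
        1 / (l : ℝ) * ∑ i, inner ℝ u (bucketMean x l i) * inner ℝ z (bucketMean x l i) := by
    rw [inner_sampleCov, hw, hw, labelScale_sq]
    simp only [bucketMean_obs, inner_add_right, real_inner_smul_right]
    simp only [Finset.mul_sum, Finset.sum_mul, ← Finset.sum_add_distrib]
    refine Finset.sum_congr rfl fun i _ => by ring
  have hb : ∀ u : EuclideanSpace ℝ (Fin d), |(inner ℝ u (crossMean e x l) : ℝ)| ≤ β * ‖u‖ :=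
    fun u => by
      rw [mul_comm]
      exact (abs_real_inner_le_norm _ _).trans (by gcongr)
  have ht : ∀ u : EuclideanSpace ℝ (Fin d), |(inner ℝ u θ : ℝ)| ≤ ‖θ‖ * ‖u‖ := fun u => by
    rw [mul_comm]; exact abs_real_inner_le_norm _ _
  have hβ : 0 ≤ β := (norm_nonneg _).trans hcross
  have e1 : |(inner ℝ u θ * inner ℝ z (crossMean e x l) : ℝ)| ≤ (‖θ‖ * ‖u‖) * (β * ‖z‖) := by
    rw [abs_mul]
    exact mul_le_mul (ht u) (hb z) (abs_nonneg _) (by positivity)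
  have e2 : |(inner ℝ z θ * inner ℝ u (crossMean e x l) : ℝ)| ≤ (‖θ‖ * ‖z‖) * (β * ‖u‖) := by
    rw [abs_mul]
    exact mul_le_mul (ht z) (hb u) (abs_nonneg _) (by positivity)
  have e3 := hcov u z
  rw [hexp, real_inner_smul_right, real_inner_smul_right]
  rw [abs_le] at *
  constructor <;> linarith [e1.1, e1.2, e2.1, e2.2, e3.1, e3.2]

/-- The noise of the bucket means fluctuates at most at its typical size. -/
structure IsTypicalNoise (e : Fin n → ℝ) (x : Fin n → EuclideanSpace ℝ (Fin d)) (l : ℕ) :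
    Prop where
  cov : ∀ u z : EuclideanSpace ℝ (Fin d),
    |1 / (l : ℝ) * ∑ i, inner ℝ u (bucketMean x l i) * inner ℝ z (bucketMean x l i) -
      1 / (bucketLen n l : ℝ) * inner ℝ u z| ≤ 704 * noiseLevel n d l * ‖u‖ * ‖z‖
  cross : ‖crossMean e x l‖ ≤ 10 * √((d : ℝ) / n)

/-- Perturbation towards `a θ`, followed by the bias from `a θ` to `θ`. The lower bound on `a²`
permits replacing `‖a θ‖` by `‖θ‖`. -/
lemma signLoss_spectralEst_le {l : ℕ} {θ : EuclideanSpace ℝ (Fin d)}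
    {v : Matrix (Fin d) (Fin d) ℝ → EuclideanSpace ℝ (Fin d)} (hv : IsTopEigenvectorMap v)
    {e : Fin n → ℝ} {x : Fin n → EuclideanSpace ℝ (Fin d)} (hn : 0 < n)
    (hx : IsTypicalNoise e x l) (hθl : n * ‖θ‖ ^ 2 ≤ 2 * l)
    (hscale : 1 / 2 ≤ labelScale e l ^ 2)
    (hbias : (1 - labelScale e l) ^ 2 * ‖θ‖ ^ 2 ≤ 9 * noiseLevel n d l)
    (hbias' : (1 - labelScale e l) ^ 2 * ‖θ‖ ^ 2 * ‖θ‖ ^ 2 ≤ 9 * noiseLevel n d l ^ 2) :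
    signLoss (spectralEst v (fun j => e j • θ + x j) l) θ ^ 2 ≤ 10 ^ 9 * noiseLevel n d l ∧
      signLoss (spectralEst v (fun j => e j • θ + x j) l) θ ^ 2 * ‖θ‖ ^ 2 ≤
        10 ^ 9 * noiseLevel n d l ^ 2 := by
  have hn' : (0 : ℝ) < n := by exact_mod_cast hn
  set A := noiseLevel n d l with hA
  have hA0 : 0 ≤ A := noiseLevel_nonneg n d l
  set a := labelScale e l with ha
  -- This is where `n‖θ‖² ≤ 2l` enters: it places the cross term below the noise level.
  have hcross : ‖θ‖ * √((d : ℝ) / n) ≤ 2 * A := by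
    refine (abs_le_of_sq_le_sq' ?_ (by positivity)).2
    rw [mul_pow, mul_pow, Real.sq_sqrt (by positivity), hA, noiseLevel_sq]
    have h1 : ‖θ‖ ^ 2 ≤ 2 * l / n := by rw [le_div_iff₀ hn']; linarith
    calc ‖θ‖ ^ 2 * ((d : ℝ) / n) ≤ 2 * l / n * ((d : ℝ) / n) := by gcongr
      _ = 2 * ((d : ℝ) * l / n ^ 2) := by field_simp
      _ ≤ _ := by
        have : 0 ≤ (d : ℝ) * l / (n : ℝ) ^ 2 := by positivity
        linarith
  obtain ⟨hv1, hv2⟩ := hv _ (sampleCov_isSymm (fun j => e j • θ + x j) l)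
  set ε := 2 * ‖θ‖ * (10 * √((d : ℝ) / n)) + 704 * A with hε
  have hε0 : 0 ≤ ε := by positivity
  have hεA : ε ≤ 744 * A := by rw [hε]; linarith
  obtain ⟨h1, h2⟩ := signLoss_rankOne_perturbation
    (Matrix.toEuclideanLin (sampleCov (fun j => e j • θ + x j) l)) hv1 hv2
    (inner_le_lambdaMax (sampleCov_isSymm _ l)) (abs_inner_sampleCov_sub_le hx.cov hx.cross)
  rw [← ha, ← hε] at h1 h2
  change signLoss (spectralEst v (fun j => e j • θ + x j) l) (a • θ) ^ 2 ≤ _ at h1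
  change signLoss (spectralEst v (fun j => e j • θ + x j) l) (a • θ) ^ 2 * _ ≤ _ at h2
  set T := spectralEst v (fun j => e j • θ + x j) l
  have hε2 : ε ^ 2 ≤ (744 * A) ^ 2 := pow_le_pow_left₀ hε0 hεA 2
  have hθ2 : signLoss T (a • θ) ^ 2 * ‖θ‖ ^ 2 ≤ 544 * ε ^ 2 := by
    rw [norm_smul, mul_pow, Real.norm_eq_abs, sq_abs] at h2
    have h3 : 0 ≤ signLoss T (a • θ) ^ 2 * ‖θ‖ ^ 2 := by positivity
    nlinarith
  have hsq : signLoss T θ ^ 2 ≤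
      2 * signLoss T (a • θ) ^ 2 + 2 * ((1 - a) ^ 2 * ‖θ‖ ^ 2) := by
    have h3 := (signLoss_triangle T (a • θ) θ).trans
      (add_le_add_right (signLoss_smul_self_le θ a) _)
    have h4 := pow_le_pow_left₀ (signLoss_nonneg _ _) h3 2
    rw [← sq_abs (1 - a)]
    nlinarith [sq_nonneg (signLoss T (a • θ) - |1 - a| * ‖θ‖)]
  constructor
  · linarith
  · have h5 := mul_le_mul_of_nonneg_right hsq (sq_nonneg ‖θ‖)
    have : 0 ≤ A ^ 2 := by positivity
    linarith

/-- As `1 - a ≤ 1 - a² ≤ 3t/g`, the second bound reduces to `t² n² θ⁴ ≤ d g³`. For `t = δ'` (later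
`nδ`) this is the balance condition; for `t = d` it follows from `g ≥ d` and `g ≥ nθ²`. -/
lemma bias_le {g F a t A δ' : ℝ} {θ : ℝ} (hn : 0 < n) (hd : 0 < d) (hg : 0 < g) (ha0 : 0 ≤ a)
    (ha1 : a ≤ 1) (hF : F ≤ 3 * t) (haF : 1 - a ^ 2 ≤ F / g) (hA0 : 0 ≤ A)
    (hA : A ^ 2 = d * g / (n : ℝ) ^ 2) (ht : t = δ' ∨ t = d) (hgd : d ≤ g)
    (hgθ : n * θ ^ 2 ≤ g) (hg3 : δ' ^ 2 * (n : ℝ) ^ 2 * θ ^ 4 / d ≤ g ^ 3) :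
    (1 - a) ^ 2 * θ ^ 2 ≤ 9 * A ∧ (1 - a) ^ 2 * θ ^ 2 * θ ^ 2 ≤ 9 * A ^ 2 := by
  have hn' : (0 : ℝ) < n := by exact_mod_cast hn
  have hd' : (0 : ℝ) < d := by exact_mod_cast hd
  have h1 : 1 - a ≤ 3 * t / g := by
    calc 1 - a ≤ 1 - a ^ 2 := by nlinarith
      _ ≤ F / g := haF
      _ ≤ _ := by gcongr
  have h2 : (1 - a) ^ 2 ≤ (3 * t / g) ^ 2 := pow_le_pow_left₀ (by linarith) h1 2
  have h3 : t ^ 2 * (n : ℝ) ^ 2 * θ ^ 4 ≤ d * g ^ 3 := by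
    rcases ht with rfl | rfl
    · rw [div_le_iff₀ hd'] at hg3; linarith
    · calc (d : ℝ) ^ 2 * (n : ℝ) ^ 2 * θ ^ 4 = d * ((n * θ ^ 2) ^ 2 * d) := by ring
        _ ≤ d * (g ^ 2 * g) := by gcongr
        _ = _ := by ring
  have h4 : (1 - a) ^ 2 * θ ^ 2 * θ ^ 2 ≤ 9 * A ^ 2 := by
    calc (1 - a) ^ 2 * θ ^ 2 * θ ^ 2 ≤ (3 * t / g) ^ 2 * θ ^ 2 * θ ^ 2 := by gcongr
      _ = 9 * (t ^ 2 * (n : ℝ) ^ 2 * θ ^ 4) / (g ^ 2 * (n : ℝ) ^ 2) := by field_simp; ring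
      _ ≤ 9 * (d * g ^ 3) / (g ^ 2 * (n : ℝ) ^ 2) := by gcongr
      _ = 9 * A ^ 2 := by rw [hA]; field_simp
  refine ⟨?_, h4⟩
  -- The first bound follows from the second: either `θ² ≤ A` and the bias is at most `θ²`, or
  -- dividing `9A²` by `θ² > A` suffices.
  have h5 : (1 - a) ^ 2 * θ ^ 2 ≤ θ ^ 2 := by
    have : (1 - a) ^ 2 ≤ 1 := by nlinarith
    nlinarith [sq_nonneg θ]
  rcases le_or_gt (θ ^ 2) A with h | h
  · linarith
  · by_contra hc
    push Not at hc
    have h6 : 9 * A * A ≤ (1 - a) ^ 2 * θ ^ 2 * θ ^ 2 :=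
      mul_le_mul hc.le h.le hA0 (by positivity)
    have h7 : 9 * A * θ ^ 2 < (1 - a) ^ 2 * θ ^ 2 * θ ^ 2 :=
      mul_lt_mul_of_pos_right hc (by linarith)
    nlinarith

end Fixed

/-! ### The grid and the oracle -/

section Grid

variable {n d : ℕ}

lemma grid_gridTop_le (hdn : d ≤ n) : grid d (gridTop n d) ≤ n :=
  Nat.findGreatest_spec (P := fun M => 2 ^ M * d ≤ n) (Nat.zero_le n) (by simpa using hdn)

lemma lt_two_mul_grid_gridTop (hd : 1 ≤ d) : n < 2 * grid d (gridTop n d) := by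
  by_contra hcon
  push Not at hcon
  have h1 : 2 ^ (gridTop n d + 1) * d ≤ n := by
    rw [pow_succ, mul_comm _ 2, mul_assoc]; exact hcon
  -- The search for the top index stops at `n`, which is no restriction since `m < 2 ^ m`.
  have h2 : gridTop n d + 1 ≤ n := by
    have := Nat.lt_two_pow_self (n := gridTop n d + 1)
    nlinarith
  have := Nat.le_findGreatest (P := fun M => 2 ^ M * d ≤ n) h2 h1
  unfold gridTop at this
  omega

lemma grid_mono : Monotone (grid d) := fun _ _ h =>
  Nat.mul_le_mul_right _ (Nat.pow_le_pow_right (by norm_num) h)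

lemma le_grid (d i : ℕ) : d ≤ grid d i := Nat.le_mul_of_pos_left _ (by positivity)

lemma grid_succ (d i : ℕ) : grid d (i + 1) = 2 * grid d i := by unfold grid; ring

lemma bucketLen_gridTop (hd : 1 ≤ d) (hdn : d ≤ n) : bucketLen n (grid d (gridTop n d)) = 1 := by
  have h1 := grid_gridTop_le hdn
  have h2 := lt_two_mul_grid_gridTop (n := n) hd
  exact Nat.div_eq_of_lt_le (by omega) (by omega)

/-- The term of the oracle `ℓ**` at which the squared bias `(δ n / l)² ‖θ‖²` and the variance
`d l / (n² ‖θ‖²)` balance. -/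
noncomputable def balanceLevel (n d : ℕ) (δ : ℝ) (θ : EuclideanSpace ℝ (Fin d)) : ℝ :=
  δ ^ (2 / 3 : ℝ) * (n : ℝ) ^ (4 / 3 : ℝ) * ‖θ‖ ^ (4 / 3 : ℝ) / (d : ℝ) ^ (1 / 3 : ℝ)

lemma balanceLevel_nonneg {δ : ℝ} (hδ : 0 ≤ δ) (θ : EuclideanSpace ℝ (Fin d)) :
    0 ≤ balanceLevel n d δ θ := by
  unfold balanceLevel; positivity

lemma balanceLevel_pow_three {δ : ℝ} (hδ : 0 ≤ δ) (θ : EuclideanSpace ℝ (Fin d)) :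
    balanceLevel n d δ θ ^ 3 = δ ^ 2 * (n : ℝ) ^ 4 * ‖θ‖ ^ 4 / d := by
  have key : ∀ (x : ℝ) (r : ℝ) (m : ℕ), 0 ≤ x → r * 3 = m → (x ^ r) ^ 3 = x ^ m := by
    intro x r m hx hr
    rw [← Real.rpow_natCast (x ^ r) 3, ← Real.rpow_mul hx]
    push_cast
    rw [hr, Real.rpow_natCast]
  unfold balanceLevel
  rw [div_pow, mul_pow, mul_pow, key δ _ 2 hδ (by norm_num), key n _ 4 (by positivity) (by norm_num),
    key ‖θ‖ _ 4 (norm_nonneg _) (by norm_num), key d _ 1 (by positivity) (by norm_num), pow_one]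

/-- The oracle number of buckets, without rounding and truncation. -/
noncomputable def oracleLevel (n d : ℕ) (δ : ℝ) (θ : EuclideanSpace ℝ (Fin d)) : ℝ :=
  max d (max (max (n * δ) (balanceLevel n d δ θ)) (n * ‖θ‖ ^ 2))

/-! ### From the oracle level to the rates. -/

lemma le_mul_ellStarStar {δ : ℝ} {θ : EuclideanSpace ℝ (Fin d)} {l : ℕ} {c : ℝ} (hc : 1 ≤ c)
    (hln : l ≤ n) (hl : (l : ℝ) ≤ c * oracleLevel n d δ θ) :
    (l : ℝ) ≤ c * (ellStarStar n d δ θ : ℝ) := by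
  unfold ellStarStar
  rw [Nat.cast_min, mul_min_of_nonneg _ _ (by linarith)]
  refine le_min (hl.trans ?_) ?_
  · rw [Nat.cast_max]
    gcongr
    exact max_le_max le_rfl (Nat.le_ceil _)
  · have : (l : ℝ) ≤ n := by exact_mod_cast hln
    nlinarith [(Nat.cast_nonneg n : (0 : ℝ) ≤ n)]

/-- The local rate is the second hypothesis with `l` replaced by a multiple of `ℓ**`. For the global
rate the dominant term of the oracle decides: `d` and `nδ` use the `A`-bound, `n‖θ‖²` uses the
`A²`-bound, and the balance term needs both. -/
lemma le_rates {δ : ℝ} (hδ : 0 ≤ δ) {θ : EuclideanSpace ℝ (Fin d)} {l : ℕ} {x c : ℝ}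
    (hd : 1 ≤ d) (hdl : d ≤ l) (hln : l ≤ n) (hl : (l : ℝ) ≤ 12 * oracleLevel n d δ θ)
    (hc : 0 < c) (hx0 : 0 ≤ x) (hx : x ≤ c * noiseLevel n d l)
    (hx' : x * ‖θ‖ ^ 2 ≤ c * noiseLevel n d l ^ 2) :
    x ≤ 12 * c * localRate n d δ θ ∧ x ≤ 12 * c * globalRate n d δ := by
  have hd' : (0 : ℝ) < d := by exact_mod_cast hd
  have hl' : (0 : ℝ) < l := by exact_mod_cast hd.trans hdl
  have hn' : (0 : ℝ) < n := by exact_mod_cast (hd.trans hdl).trans hln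
  have hA0 := noiseLevel_nonneg n d l
  have hA2 := noiseLevel_sq n d l
  set A := noiseLevel n d l
  have hpos : ∀ t : ℝ, (l : ℝ) ≤ 12 * (t * ‖θ‖ ^ 2) → 0 < ‖θ‖ ^ 2 := by
    intro t ht
    rcases (sq_nonneg ‖θ‖).lt_or_eq with h | h
    · exact h
    · rw [← h] at ht; linarith
  have hr1 : 0 ≤ √(δ * d / n) := Real.sqrt_nonneg _
  have hr2 : 0 ≤ (d : ℝ) / n := by positivity
  have hglob : x ≤ 12 * c * globalRate n d δ := by
    have hred : x ≤ 12 * c * √(δ * d / n) ∨ x ≤ 12 * c * ((d : ℝ) / n) := by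
      have hcases : (l : ℝ) ≤ 12 * d ∨ (l : ℝ) ≤ 12 * (n * δ) ∨
          (l : ℝ) ≤ 12 * balanceLevel n d δ θ ∨ (l : ℝ) ≤ 12 * (n * ‖θ‖ ^ 2) := by
        unfold oracleLevel at hl
        rcases max_choice (d : ℝ) (max (max (n * δ) (balanceLevel n d δ θ)) (n * ‖θ‖ ^ 2))
          with h | h
        · exact Or.inl (h ▸ hl)
        rw [h] at hl
        rcases max_choice (max (n * δ) (balanceLevel n d δ θ)) (n * ‖θ‖ ^ 2) with h | h
        · rw [h] at hl
          rcases max_choice (n * δ) (balanceLevel n d δ θ) with h | h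
          · exact Or.inr (Or.inl (h ▸ hl))
          · exact Or.inr (Or.inr (Or.inl (h ▸ hl)))
        · exact Or.inr (Or.inr (Or.inr (h ▸ hl)))
      rcases hcases with h | h | h | h
      · right
        have : A ≤ 12 * ((d : ℝ) / n) := by
          refine (abs_le_of_sq_le_sq' ?_ (by positivity)).2
          rw [hA2]
          calc (d : ℝ) * l / n ^ 2 ≤ d * (12 * d) / n ^ 2 := by gcongr
            _ = 12 * ((d : ℝ) ^ 2 / n ^ 2) := by ring
            _ ≤ 144 * ((d : ℝ) ^ 2 / n ^ 2) := by gcongr; norm_num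
            _ = _ := by ring
        nlinarith
      · left
        have : A ≤ 12 * √(δ * d / n) := by
          refine (abs_le_of_sq_le_sq' ?_ (by positivity)).2
          rw [hA2, mul_pow, Real.sq_sqrt (by positivity)]
          calc (d : ℝ) * l / n ^ 2 ≤ d * (12 * (n * δ)) / n ^ 2 := by gcongr
            _ = 12 * (δ * d / n) := by field_simp
            _ ≤ 12 ^ 2 * (δ * d / n) := by gcongr; norm_num
        nlinarith
      · left
        have h3 : (l : ℝ) ^ 3 ≤ 1728 * (δ ^ 2 * (n : ℝ) ^ 4 * ‖θ‖ ^ 4 / d) := by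
          rw [← balanceLevel_pow_three hδ]
          calc (l : ℝ) ^ 3 ≤ (12 * balanceLevel n d δ θ) ^ 3 := by gcongr
            _ = _ := by ring
        have hθ : 0 < ‖θ‖ ^ 2 := by
          rcases (sq_nonneg ‖θ‖).lt_or_eq with h | h
          · exact h
          · rw [show ‖θ‖ ^ 4 = (‖θ‖ ^ 2) ^ 2 by ring, ← h] at h3
            have : 0 < (l : ℝ) ^ 3 := by positivity
            norm_num at h3
            linarith
        -- Multiplying the two bounds gives `x² ‖θ‖² ≤ c² A³`; squaring produces `l³`, where the
        -- cube of the balance level brings a factor `‖θ‖⁴` that cancels.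
        have h4 : x * (x * ‖θ‖ ^ 2) ≤ (c * A) * (c * A ^ 2) :=
          mul_le_mul hx hx' (by positivity) (by positivity)
        have h5 : (x ^ 2 * ‖θ‖ ^ 2) ^ 2 ≤ (144 * c ^ 2 * (δ * d / n) * ‖θ‖ ^ 2) ^ 2 := by
          calc (x ^ 2 * ‖θ‖ ^ 2) ^ 2 = (x * (x * ‖θ‖ ^ 2)) ^ 2 := by ring
            _ ≤ ((c * A) * (c * A ^ 2)) ^ 2 := pow_le_pow_left₀ (by positivity) h4 2
            _ = c ^ 4 * (A ^ 2) ^ 3 := by ring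
            _ = c ^ 4 * (d ^ 3 * (l : ℝ) ^ 3 / n ^ 6) := by rw [hA2]; ring
            _ ≤ c ^ 4 * (d ^ 3 * (1728 * (δ ^ 2 * (n : ℝ) ^ 4 * ‖θ‖ ^ 4 / d)) / n ^ 6) := by gcongr
            _ = 1728 * (c ^ 4 * (δ * d / n) ^ 2 * ‖θ‖ ^ 4) := by field_simp
            _ ≤ 144 ^ 2 * (c ^ 4 * (δ * d / n) ^ 2 * ‖θ‖ ^ 4) := by gcongr; norm_num
            _ = _ := by ring
        have h6 := (abs_le_of_sq_le_sq' h5 (by positivity)).2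
        have h7 : x ^ 2 ≤ 144 * c ^ 2 * (δ * d / n) := le_of_mul_le_mul_right h6 hθ
        refine (abs_le_of_sq_le_sq' ?_ (by positivity)).2
        rw [mul_pow, Real.sq_sqrt (by positivity)]
        linarith
      · right
        have hθ := hpos n h
        refine le_of_mul_le_mul_right (hx'.trans ?_) hθ
        rw [hA2]
        calc c * ((d : ℝ) * l / n ^ 2) ≤ c * ((d : ℝ) * (12 * (n * ‖θ‖ ^ 2)) / n ^ 2) := by gcongr
          _ = _ := by field_simp
    have e1 : 0 ≤ 12 * c * √(δ * d / n) := by positivity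
    have e2 : 0 ≤ 12 * c * ((d : ℝ) / n) := by positivity
    rw [globalRate, mul_add]
    rcases hred with h | h <;> linarith
  refine ⟨?_, hglob⟩
  unfold localRate
  split_ifs with hθ
  · exact hglob
  · rw [mul_min_of_nonneg _ _ (by positivity)]
    refine le_min hglob ?_
    have hθ2 : 0 < ‖θ‖ ^ 2 := by have := norm_pos_iff.2 hθ; positivity
    have h1 := le_mul_ellStarStar (by norm_num) hln hl
    have h2 : x ≤ c * (d * l / n ^ 2) / ‖θ‖ ^ 2 := by
      rw [le_div_iff₀ hθ2, ← hA2]; exact hx'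
    calc x ≤ c * (d * l / n ^ 2) / ‖θ‖ ^ 2 := h2
      _ ≤ c * (d * (12 * (ellStarStar n d δ θ : ℝ)) / n ^ 2) / ‖θ‖ ^ 2 := by gcongr
      _ = 12 * c * ((ellStarStar n d δ θ : ℝ) * d / ((n : ℝ) ^ 2 * ‖θ‖ ^ 2)) := by field_simp
      _ ≤ _ := by gcongr; linarith

end Grid

/-! ### The adaptive estimator -/

/-- The first grid point reaching `6` times the oracle level, or the last one. Doubling costs the
factor `12`; the `6` makes the at most `2nδ + d` flips fill no more than half of the buckets. -/
lemma exists_oracle_index {n d : ℕ} {δ : ℝ} {θ : EuclideanSpace ℝ (Fin d)} :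
    ∃ i₀ ≤ gridTop n d, (grid d i₀ : ℝ) ≤ 12 * oracleLevel n d δ θ ∧
      ∀ i, i₀ ≤ i → i ≤ gridTop n d →
        i = gridTop n d ∨ 6 * oracleLevel n d δ θ ≤ (grid d i : ℝ) := by
  classical
  have hex : ∃ i, i = gridTop n d ∨ 6 * oracleLevel n d δ θ ≤ (grid d i : ℝ) := ⟨_, Or.inl rfl⟩
  have hd0 : (d : ℝ) ≤ oracleLevel n d δ θ := le_max_left _ _
  have hd1 : (0 : ℝ) ≤ d := by positivity
  have hle : Nat.find hex ≤ gridTop n d := Nat.find_min' hex (Or.inl rfl)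
  refine ⟨Nat.find hex, hle, ?_, fun i hi hiM => ?_⟩
  · rcases Nat.eq_zero_or_pos (Nat.find hex) with h | h
    · rw [h]
      simp only [grid, pow_zero, one_mul]
      linarith
    · have hmin := Nat.find_min hex (Nat.sub_lt h one_pos)
      push Not at hmin
      have hs := grid_succ d (Nat.find hex - 1)
      rw [Nat.sub_add_cancel h] at hs
      rw [hs]
      push_cast
      linarith [hmin.2]
  · rcases Nat.find_spec hex with h | h
    · exact Or.inl (by omega)
    · right
      refine h.trans ?_
      exact_mod_cast grid_mono hi

/-- All randomness is confined to the bound on the flips and to typical noise on the grid; the rest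
is deterministic. -/
theorem adaptiveEst_loss_le {n d : ℕ} {C δ : ℝ} {J : ℕ} (hC : 2 * 10 ^ 9 ≤ C)
    (hJ : (17 * C) ^ 4 ≤ 2 ^ J) (hd : 1 ≤ d) (hdn : d ≤ n) (hδ : 0 ≤ δ)
    {θ : EuclideanSpace ℝ (Fin d)} (hθ : ‖θ‖ ^ 2 ≤ 1)
    {v : Matrix (Fin d) (Fin d) ℝ → EuclideanSpace ℝ (Fin d)} (hv : IsTopEigenvectorMap v)
    {b : Fin n → Bool} {x : Fin n → EuclideanSpace ℝ (Fin d)}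
    (hb : ((flipSet b).card : ℝ) ≤ 2 * n * δ + d)
    (hx : ∀ i ≤ gridTop n d, IsTypicalNoise (signPath b) x (grid d i)) :
    signLoss (adaptiveEst C v fun j => signPath b j • θ + x j) θ ^ 2 ≤
        12 * ((34 * C) ^ 4 * 4 ^ J) * localRate n d δ θ ∧
      signLoss (adaptiveEst C v fun j => signPath b j • θ + x j) θ ^ 2 ≤
        12 * ((34 * C) ^ 4 * 4 ^ J) * globalRate n d δ := by
  have hn : 0 < n := hd.trans hdn
  have hn' : (0 : ℝ) < n := by exact_mod_cast hn
  have hd' : (0 : ℝ) < d := by exact_mod_cast hd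
  set y : Fin n → EuclideanSpace ℝ (Fin d) := fun j => signPath b j • θ + x j with hy
  set A : ℕ → ℝ := fun i => noiseLevel n d (grid d i) with hA
  have hgpos : ∀ i, (0 : ℝ) < grid d i := fun i => by exact_mod_cast hd.trans (le_grid d i)
  have hgle : ∀ i ≤ gridTop n d, grid d i ≤ n := fun i hi =>
    (grid_mono hi).trans (grid_gridTop_le hdn)
  obtain ⟨i₀, hi₀, hi₀le, hi₀ge⟩ := exists_oracle_index (n := n) (d := d) (δ := δ) (θ := θ)
  have hbal := balanceLevel_nonneg (n := n) hδ θ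
  have hloss : ∀ i, i₀ ≤ i → i ≤ gridTop n d →
      signLoss (spectralEst v y (grid d i)) θ ^ 2 ≤ 10 ^ 9 * A i ∧
        signLoss (spectralEst v y (grid d i)) θ ^ 2 * ‖θ‖ ^ 2 ≤ 10 ^ 9 * A i ^ 2 := by
    intro i hi hiM
    have hA0 := noiseLevel_nonneg n d (grid d i)
    have hg1 : 1 ≤ grid d i := hd.trans (le_grid d i)
    rcases hi₀ge i hi hiM with h | h
    -- At the last grid point the buckets are singletons, so the bias vanishes, and `‖θ‖² ≤ 1` gives
    -- `n‖θ‖² ≤ n ≤ 2l` even if the oracle level exceeds the grid.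
    · have hs : labelScale (signPath b) (grid d i) = 1 :=
        labelScale_eq_one hg1 (h ▸ bucketLen_gridTop hd hdn) b
      refine signLoss_spectralEst_le hv hn (hx i hiM) ?_ (by rw [hs]; norm_num) ?_ ?_
      · have : (n : ℝ) ≤ 2 * grid d i := by
          rw [h]; exact_mod_cast (lt_two_mul_grid_gridTop hd).le
        nlinarith
      · rw [hs]; simpa using hA0
      · rw [hs]; simpa using sq_nonneg (noiseLevel n d (grid d i))
    · have hod : (d : ℝ) ≤ oracleLevel n d δ θ := le_max_left _ _
      have hoδ : n * δ ≤ oracleLevel n d δ θ :=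
        le_max_of_le_right (le_max_of_le_left (le_max_left _ _))
      have hob : balanceLevel n d δ θ ≤ oracleLevel n d δ θ :=
        le_max_of_le_right (le_max_of_le_left (le_max_right _ _))
      have hoθ : n * ‖θ‖ ^ 2 ≤ oracleLevel n d δ θ := le_max_of_le_right (le_max_right _ _)
      have haF := one_sub_labelScale_sq_le hg1 (hgle i hiM) b
      obtain ⟨h1, h2⟩ := bias_le (t := max (n * δ) d) (δ' := n * δ) (θ := ‖θ‖)
        (A := noiseLevel n d (grid d i)) hn hd (hgpos i)
        (labelScale_nonneg _ _) (labelScale_le_one (abs_signPath_le b) _)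
        (hb.trans (by linarith [le_max_left (n * δ) (d : ℝ), le_max_right (n * δ) (d : ℝ)]))
        haF hA0 (noiseLevel_sq _ _ _) (max_choice _ _) (by linarith) (by linarith) (by
          calc (n * δ) ^ 2 * (n : ℝ) ^ 2 * ‖θ‖ ^ 4 / d = balanceLevel n d δ θ ^ 3 := by
                rw [balanceLevel_pow_three hδ]; ring
            _ ≤ _ := pow_le_pow_left₀ hbal (by linarith) 3)
      refine signLoss_spectralEst_le hv hn (hx i hiM) (by linarith) ?_ h1 h2
      have : ((flipSet b).card : ℝ) / grid d i ≤ 1 / 2 := by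
        rw [div_le_iff₀ (hgpos i)]; linarith
      linarith
  have hiff : ∀ (k : ℕ) (s z : ℝ), z ≤ threshold C n d (grid d k) s ↔
      z ≤ 4 * C ^ 2 * A k ∧ z * s ^ 2 ≤ 4 * C ^ 2 * A k ^ 2 := fun k s z => le_threshold_iff hn
  set m₁ := lepskiIndex n (spectralEst v y)
    (fun k => threshold C n d (grid d k) ‖spectralEst v y (grid d k)‖) with hm₁
  set m₂ := lepskiIndex n (spectralEst v y)
    (fun k => threshold C n d (grid d k) ‖spectralEst v y (grid d m₁)‖) with hm₂
  have hspec₁ := lepskiIndex_spec (n := n) (spectralEst v y)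
    (fun k => threshold C n d (grid d k) ‖spectralEst v y (grid d k)‖)
  have hspec₂ := lepskiIndex_spec (n := n) (spectralEst v y)
    (fun k => threshold C n d (grid d k) ‖spectralEst v y (grid d m₁)‖)
  rw [← hm₁] at hspec₁
  rw [← hm₂] at hspec₂
  obtain ⟨hf1, hf2⟩ := two_step_lepski (T := fun i => spectralEst v y (grid d i)) (A := A)
    (B := 10 ^ 9) (C := C) (θ := θ) (J := J) (i₀ := i₀) (M := gridTop n d) (m₁ := m₁) (m₂ := m₂)
    (fun i => by
      have := hgpos i
      simp only [hA, noiseLevel]; positivity)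
    (fun i => by simp only [hA, noiseLevel_sq, grid_succ]; push_cast; ring)
    (by norm_num) hC hJ hi₀ hloss
    (fun k hk hkM => ((hiff k _ _).1 (hspec₁.2 k hk hkM)).1)
    (fun i hi h => lepskiIndex_le hi fun k hk hkM => (hiff k _ _).2 (h k hk hkM))
    (fun k hk hkM => (hiff k _ _).1 (hspec₂.2 k hk hkM))
    (fun i hi h => lepskiIndex_le hi fun k hk hkM => (hiff k _ _).2 (h k hk hkM))
  have hCpos : 0 < C := by linarith
  exact le_rates hδ hd (le_grid d i₀) (hgle i₀ hi₀) hi₀le (by positivity) (sq_nonneg _) hf1 hf2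

/-! ### The union bound over the grid and the factor `log (n / d)`. -/

lemma exp_le_logFactor {n d : ℕ} (hd : 1 ≤ d) (hdn : d ≤ n) :
    (2 * (gridTop n d : ℝ) + 3) * Real.exp (-d) ≤
      12 * logFactor n d * Real.exp (-(1 / 2) * d) := by
  have hd' : (1 : ℝ) ≤ d := by exact_mod_cast hd
  have hn' : (0 : ℝ) < n := by exact_mod_cast hd.trans hdn
  have he : Real.exp (-(d : ℝ)) = Real.exp (-(1 / 2) * d) * Real.exp (-(1 / 2) * d) := by
    rw [← Real.exp_add]; congr 1; ring
  have he0 := Real.exp_pos (-(1 / 2) * (d : ℝ))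
  suffices h : (2 * (gridTop n d : ℝ) + 3) * Real.exp (-(1 / 2) * d) ≤ 12 * logFactor n d by
    rw [he, ← mul_assoc]
    gcongr
  have he1 : Real.exp (-(1 / 2) * (d : ℝ)) ≤ 1 := Real.exp_le_one_iff.2 (by linarith)
  have hM := grid_gridTop_le hdn
  unfold logFactor
  split_ifs with hnd
  · have hM0 : gridTop n d = 0 := by
      by_contra h
      have h1 := grid_mono (d := d) (Nat.one_le_iff_ne_zero.2 h)
      simp only [grid, pow_one] at h1 hM
      omega
    rw [hM0]
    push_cast
    linarith
  · rcases Nat.eq_zero_or_pos (gridTop n d) with h | h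
    -- One grid point but `d < n < 2d`: the logarithm may be as small as order `1 / d`, and the
    -- spare factor `exp (-d/2) ≤ 2/d` compensates.
    · have h2 := lt_two_mul_grid_gridTop (n := n) hd
      rw [h] at h2 ⊢
      simp only [grid, pow_zero, one_mul] at h2
      have h2' : (n : ℝ) ≤ 2 * d := by exact_mod_cast h2.le
      have h3 : (d : ℝ) + 1 ≤ n := by exact_mod_cast lt_of_le_of_ne hdn (Ne.symm hnd)
      have h4 := Real.one_sub_inv_le_log_of_pos (x := (n : ℝ) / d) (by positivity)
      have h5 : 1 / (2 * (d : ℝ)) ≤ 1 - ((n : ℝ) / d)⁻¹ := by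
        have : 1 - ((n : ℝ) / d)⁻¹ = (n - d) / n := by field_simp
        rw [this, div_le_div_iff₀ (by positivity) hn']
        nlinarith
      have h6 : Real.exp (-(1 / 2) * (d : ℝ)) ≤ 2 / d := by
        have := Real.add_one_le_exp (1 / 2 * (d : ℝ))
        rw [neg_mul, Real.exp_neg, inv_le_comm₀ (Real.exp_pos _) (by positivity), inv_div]
        linarith
      push_cast
      calc (2 * (0 : ℝ) + 3) * Real.exp (-(1 / 2) * d) ≤ (2 * (0 : ℝ) + 3) * (2 / d) := by gcongr
        _ = 12 * (1 / (2 * (d : ℝ))) := by field_simp; norm_num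
        _ ≤ _ := by linarith
    · have hM1 : (1 : ℝ) ≤ gridTop n d := by exact_mod_cast h
      have h1 : (2 : ℝ) ^ gridTop n d ≤ (n : ℝ) / d := by
        rw [le_div_iff₀ (by positivity)]
        exact_mod_cast hM
      have h2 := Real.log_le_log (by positivity) h1
      rw [Real.log_pow] at h2
      have h3 := Real.log_two_gt_d9
      nlinarith

/-- One event for the flips and two for each of the `gridTop n d + 1` grid points make `2 * gridTop
n d + 3`. The selection `v` need not be measurable: the failure event is only bounded by
monotonicity and subadditivity. -/
theorem measure_adaptiveEst_loss_gt_le {n d : ℕ} {C δ : ℝ} {J : ℕ} (hC : 2 * 10 ^ 9 ≤ C)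
    (hJ : (17 * C) ^ 4 ≤ 2 ^ J) (hd : 1 ≤ d) (hdn : d ≤ n) (hδ : 0 ≤ δ) (hδ' : δ ≤ 1)
    {θ : EuclideanSpace ℝ (Fin d)} (hθ : ‖θ‖ ^ 2 ≤ 1)
    {v : Matrix (Fin d) (Fin d) ℝ → EuclideanSpace ℝ (Fin d)} (hv : IsTopEigenvectorMap v)
    {Ω : Type*} [MeasurableSpace Ω] {P : Measure Ω} [IsProbabilityMeasure P]
    {η : Fin n → Ω → ℝ} {ξ : Fin n → Ω → EuclideanSpace ℝ (Fin d)} (hM : IsModel P δ η ξ) :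
    P {ω | ¬ (signLoss (adaptiveEst C v (obs θ η ξ ω)) θ ^ 2 ≤
          12 * ((34 * C) ^ 4 * 4 ^ J) * localRate n d δ θ ∧
        signLoss (adaptiveEst C v (obs θ η ξ ω)) θ ^ 2 ≤
          12 * ((34 * C) ^ 4 * 4 ^ J) * globalRate n d δ)} ≤
      ENNReal.ofReal (12 * logFactor n d * Real.exp (-(1 / 2) * d)) := by
  set R := Finset.range (gridTop n d + 1) with hR
  set E₀ : Set Ω := {ω | ¬ ∃ b, (∀ i, η i ω = signPath b i) ∧
    ((flipSet b).card : ℝ) ≤ 2 * n * δ + d} with hE₀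
  set E₁ : ℕ → Set Ω := fun m => {ω | ¬ ∀ x z : EuclideanSpace ℝ (Fin d),
      |1 / (grid d m : ℝ) * ∑ i, inner ℝ x (bucketMean (fun j => ξ j ω) (grid d m) i) *
          inner ℝ z (bucketMean (fun j => ξ j ω) (grid d m) i) -
          1 / (bucketLen n (grid d m) : ℝ) * inner ℝ x z| ≤
        704 * noiseLevel n d (grid d m) * ‖x‖ * ‖z‖} with hE₁
  set E₂ : ℕ → Set Ω := fun m => {ω | ∃ b, (∀ i, η i ω = signPath b i) ∧
      10 * √((d : ℝ) / n) < ‖crossMean (signPath b) (fun j => ξ j ω) (grid d m)‖} with hE₂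
  have hgle : ∀ m ∈ R, grid d m ≤ n := fun m hm =>
    (grid_mono (Nat.lt_succ_iff.1 (Finset.mem_range.1 hm))).trans (grid_gridTop_le hdn)
  have hsub : {ω | ¬ (signLoss (adaptiveEst C v (obs θ η ξ ω)) θ ^ 2 ≤
          12 * ((34 * C) ^ 4 * 4 ^ J) * localRate n d δ θ ∧
        signLoss (adaptiveEst C v (obs θ η ξ ω)) θ ^ 2 ≤
          12 * ((34 * C) ^ 4 * 4 ^ J) * globalRate n d δ)} ⊆
      E₀ ∪ ((⋃ m ∈ R, E₁ m) ∪ ⋃ m ∈ R, E₂ m) := by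
    intro ω hω
    by_contra hcon
    simp only [Set.mem_union, Set.mem_iUnion, not_or, not_exists, exists_prop, not_and] at hcon
    obtain ⟨h0, h1, h2⟩ := hcon
    simp only [hE₀, Set.mem_ofPred_eq, not_not] at h0
    obtain ⟨b, hb, hbF⟩ := h0
    have hobs : obs θ η ξ ω = fun j => signPath b j • θ + ξ j ω := by
      funext j; rw [obs, hb]
    refine hω ?_
    rw [hobs]
    refine adaptiveEst_loss_le hC hJ hd hdn hδ hθ hv hbF fun m hm => ⟨?_, ?_⟩
    · have := h1 m (Finset.mem_range.2 (Nat.lt_succ_iff.2 hm))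
      simpa only [hE₁, Set.mem_ofPred_eq, not_not] using this
    · have := h2 m (Finset.mem_range.2 (Nat.lt_succ_iff.2 hm))
      simp only [hE₂, Set.mem_ofPred_eq, not_exists, not_and, not_lt] at this
      exact this b hb
  calc _ ≤ P (E₀ ∪ ((⋃ m ∈ R, E₁ m) ∪ ⋃ m ∈ R, E₂ m)) := measure_mono hsub
    _ ≤ P E₀ + (∑ m ∈ R, P (E₁ m) + ∑ m ∈ R, P (E₂ m)) :=
        (measure_union_le _ _).trans (add_le_add le_rfl ((measure_union_le _ _).trans
          (add_le_add (measure_biUnion_finset_le _ _) (measure_biUnion_finset_le _ _))))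
    _ ≤ ENNReal.ofReal (Real.exp (-d)) + (∑ _m ∈ R, ENNReal.ofReal (Real.exp (-d)) +
          ∑ _m ∈ R, ENNReal.ofReal (Real.exp (-d))) := by
        refine add_le_add (hM.chain.measure_flips_gt_le (hd.trans hdn) hδ hδ')
          (add_le_add (Finset.sum_le_sum fun m hm => ?_) (Finset.sum_le_sum fun m hm => ?_))
        · exact hM.noise.measure_noiseCov_gt_le hd (le_grid d m) (hgle m hm)
        · exact hM.measure_crossMean_gt_le hd (le_grid d m) (hgle m hm)
    _ = ENNReal.ofReal ((2 * (gridTop n d : ℝ) + 3) * Real.exp (-d)) := by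
        rw [Finset.sum_const, hR, Finset.card_range, nsmul_eq_mul, ← ENNReal.ofReal_natCast,
          ← ENNReal.ofReal_mul (by positivity), ← ENNReal.ofReal_add (by positivity) (by positivity),
          ← ENNReal.ofReal_add (by positivity) (by positivity)]
        congr 1
        push_cast
        ring
    _ ≤ _ := ENNReal.ofReal_le_ofReal (exp_le_logFactor hd hdn)

end MarkovMixture

theorem theorem5 :
    ∃ C₀ : ℝ, 0 < C₀ ∧ ∀ C : ℝ, C₀ ≤ C →
      ∃ c c₀ c₁ : ℝ, 0 < c ∧ 0 < c₀ ∧ 0 < c₁ ∧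
        ∀ (n d : ℕ), 1 ≤ d → d ≤ n →
        ∀ (δ : ℝ), 0 < δ → δ < 1 / 2 →
        ∀ (θ : EuclideanSpace ℝ (Fin d)), ‖θ‖ ^ 2 ≤ 1 →
        ∀ (v : Matrix (Fin d) (Fin d) ℝ → EuclideanSpace ℝ (Fin d)), IsTopEigenvectorMap v →
        ∀ (Ω : Type*) [MeasurableSpace Ω] (P : Measure Ω) [IsProbabilityMeasure P]
          (η : Fin n → Ω → ℝ) (ξ : Fin n → Ω → EuclideanSpace ℝ (Fin d)),
          IsModel P δ η ξ →
            P {ω | ¬ signLoss (adaptiveEst C v (obs θ η ξ ω)) θ ^ 2 ≤ c * localRate n d δ θ}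
                ≤ ENNReal.ofReal (c₁ * logFactor n d * Real.exp (-c₀ * d)) ∧
            P {ω | ¬ signLoss (adaptiveEst C v (obs θ η ξ ω)) θ ^ 2 ≤ c * globalRate n d δ}
                ≤ ENNReal.ofReal (c₁ * logFactor n d * Real.exp (-c₀ * d)) := by
  refine ⟨2 * 10 ^ 9, by norm_num, fun C hC => ?_⟩
  -- The shift `J`, and with it the final constant, depends on `C` alone; `2 * 10 ^ 9` is twice the
  -- constant of the fixed-bucket bound.
  obtain ⟨J, hJ⟩ := pow_unbounded_of_one_lt ((17 * C) ^ 4) (one_lt_two : (1 : ℝ) < 2)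
  have hCpos : 0 < C := by linarith
  refine ⟨12 * ((34 * C) ^ 4 * 4 ^ J), 1 / 2, 12, by positivity, by norm_num, by norm_num, ?_⟩
  intro n d hd hdn δ hδ hδ' θ hθ v hv Ω _ P _ η ξ hM
  have h := measure_adaptiveEst_loss_gt_le hC hJ.le hd hdn hδ.le (by linarith) hθ hv hM
  exact ⟨(measure_mono (Set.ofPred_subset_ofPred.2 fun _ hω hcon => hω hcon.1)).trans h,
    (measure_mono (Set.ofPred_subset_ofPred.2 fun _ hω hcon => hω hcon.2)).trans h⟩
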